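/- For each dimension $d$ let $f=N(0,I)$ be the standard Gaussian distribution on $\mathbb{R}^d$ and let $A\subset\mathbb{R}^d$ be measurable; write $p_f(A)=\int_A f$ and $f|_A=f\,\mathbf 1_A/p_f(A)$. All objects ($A$, $r$, $n_g$, $n_p$, the directions, the samples and the probability space on which they are defined) depend on $d$. A sequence of (possibly random) probability distributions $g$ on $\mathbb{R}^d$ is called efficient in high dimension for $A$ if, for every sequence of sample sizes $n_p\to\infty$, with $\ell=f/g$ and $Y_1,\dots,Y_{n_p}$ i.i.d. of distribution $g$ given $g$, both $$\mathbb{E}\Big(\frac{\max_{i\le n_p}\ell(Y_i)}{\sum_{i\le n_p}\ell(Y_i)}\,\Big|\,g\Big)\quad\text{and}\quad \mathbb{E}\Big(\Big|\frac{1}{p_f(A)\,n_p}\sum_{i\le n_p}\ell(Y_i)\mathbf 1_A(Y_i)-1\Big|\,\Big|\,g\Big)$$ converge in distribution to $0$ as $d\to\infty$. Theorem. Assume that $\inf_d p_f(A)>0$. For each $d$ let $r\le d$ and let $(d_1,\dots,d_r)$ be an orthonormal family in $\mathbb{R}^d$, possibly random. Let $\mu_A$ and $\Sigma_A$ be the mean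 and the covariance matrix of $f|_A$, and $$g_{\mathrm{proj}}=N(\mu_A,\Sigma_{\mathrm{proj}}),\qquad \Sigma_{\mathrm{proj}}=I+\sum_{k=1}^r(v_k-1)\,d_kd_k^\top,\qquad v_k=d_k^\top\Sigma_A d_k .$$ Then $g_{\mathrm{proj}}$ is efficient in high dimension for $A$. Let moreover $Y_{A,1},\dots,Y_{A,n_g}$ be i.i.d. with distribution $f|_A$, and put $$\hat\mu_A=\frac1{n_g}\sum_{k=1}^{n_g}Y_{A,k},\qquad \hat\Sigma_A=\frac1{n_g}\sum_{k=1}^{n_g}Y_{A,k}Y_{A,k}^\top-\hat\mu_A\hat\mu_A^\top,$$ $$\hat g_{\mathrm{proj}}=N(\hat\mu_A,\hat\Sigma_{\mathrm{proj}}),\qquad \hat\Sigma_{\mathrm{proj}}=I+\sum_{k=1}^r(\hat v_k-1)\,d_kd_k^\top,\qquad \hat v_k=d_k^\top\hat\Sigma_A d_k .$$ If in addition $n_g/(rd)\to\infty$ as $d\to\infty$ (in particular $r\ge1$ for all large $d$) and $(d_1,\dots,d_r)$ is independent of $(Y_{A,1},\dots,Y_{A,n_g})$, then $\hat g_{\mathrm{proj}}$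 is efficient in high dimension for $A$. (When $\hat\Sigma_{\mathrm{proj}}$ is singular, $f/\hat g_{\mathrm{proj}}$ means the Radon–Nikodym derivative of the absolutely continuous part of $f$ with respect to $\hat g_{\mathrm{proj}}$.) -/

import Mathlib

open MeasureTheory ProbabilityTheory Filter Topology

namespace HighDimIS

noncomputable section

/-- The space `ℝ^d` with its Euclidean norm. -/
abbrev E (d : ℕ) : Type := EuclideanSpace ℝ (Fin d)

/-- The standard Gaussian distribution `f = N(0, I)` on `ℝ^d`. -/
abbrev stdNormal (d : ℕ) : Measure (E d) := stdGaussian (E d)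

/-- The likelihood ratio `ℓ = f / g` of two distributions: the Radon-Nikodym derivative of `f`
with respect to `g`, i.e. the ratio of the densities when both have one and `g`'s is positive. -/
def likelihoodRatio {d : ℕ} (f g : Measure (E d)) (y : E d) : ℝ :=
  (f.rnDeriv g y).toReal

/-- `E(max_i ℓ(Y_i) / ∑_i ℓ(Y_i) | g)` for `Y_1, …, Y_n` i.i.d. with distribution `g`. -/
def weightDegeneracy {d : ℕ} (f g : Measure (E d)) (n : ℕ) : ℝ :=
  ∫ y : Fin n → E d,
    (⨆ i, likelihoodRatio f g (y i)) / ∑ i, likelihoodRatio f g (y i)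
    ∂(Measure.pi fun _ => g)

/-- `E(|(p_f(A) n)⁻¹ ∑_i ℓ(Y_i) 1_A(Y_i) - 1| | g)` for `Y_1, …, Y_n` i.i.d. with
distribution `g`. -/
def relativeL1Error {d : ℕ} (f : Measure (E d)) (A : Set (E d)) (g : Measure (E d))
    (n : ℕ) : ℝ :=
  ∫ y : Fin n → E d,
    |1 / (f.real A * n) * ∑ i, likelihoodRatio f g (y i) * A.indicator 1 (y i) - 1|
    ∂(Measure.pi fun _ => g)

/-- A sequence of real random variables, the `d`-th one defined on the probability space
`(Ω d, P d)`, converges in distribution to the constant `0`. -/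
def TendstoZeroInDistribution {Ω : ℕ → Type*} [∀ d, MeasurableSpace (Ω d)]
    (P : ∀ d, Measure (Ω d)) [∀ d, IsProbabilityMeasure (P d)] (Z : ∀ d, Ω d → ℝ) : Prop :=
  TendstoInDistribution Z atTop (fun _ : Unit => (0 : ℝ)) P (Measure.dirac ())

/-- High-dimensional efficiency for `A` (with initial distributions `f`) of a sequence `g` of
random auxiliary distributions, the `d`-th one defined on the probability space `(Ω d, P d)`. -/
def EfficientInHighDimension {Ω : ℕ → Type*} [∀ d, MeasurableSpace (Ω d)]
    (P : ∀ d, Measure (Ω d)) [∀ d, IsProbabilityMeasure (P d)]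
    (f : ∀ d, Measure (E d)) (A : ∀ d, Set (E d)) (g : ∀ d, Ω d → Measure (E d)) : Prop :=
  ∀ np : ℕ → ℕ, Tendsto np atTop atTop →
    TendstoZeroInDistribution P (fun d ω => weightDegeneracy (f d) (g d ω) (np d)) ∧
    TendstoZeroInDistribution P (fun d ω => relativeL1Error (f d) (A d) (g d ω) (np d))

/-- The distribution `f|_A`: the standard Gaussian distribution conditioned on `A`. -/
def condNormal {d : ℕ} (A : Set (E d)) : Measure (E d) := (stdNormal d)[|A]

/-- The mean `μ_A` of `f|_A`. -/
def condMean {d : ℕ} (A : Set (E d)) : E d := ∫ x, x ∂(condNormal A)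

/-- The covariance matrix `Σ_A` of `f|_A`. -/
def condCov {d : ℕ} (A : Set (E d)) : Matrix (Fin d) (Fin d) ℝ :=
  Matrix.of fun i j => cov[fun x => x i, fun x => x j; condNormal A]

/-- `∑_k (v_k - 1) d_k d_kᵀ + I` with `v_k = d_kᵀ S d_k`. -/
def projCov {d r : ℕ} (S : Matrix (Fin d) (Fin d) ℝ) (dir : Fin r → E d) :
    Matrix (Fin d) (Fin d) ℝ :=
  ∑ k, ((dir k).ofLp ⬝ᵥ (S.mulVec (dir k).ofLp) - 1) •
    Matrix.vecMulVec (dir k).ofLp (dir k).ofLp + 1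

/-- The empirical mean of `y_1, …, y_n`. -/
def empMean {d n : ℕ} (y : Fin n → E d) : E d := (n : ℝ)⁻¹ • ∑ k, y k

/-- The empirical covariance `n⁻¹ ∑_k y_k y_kᵀ - m mᵀ`, with `m` the empirical mean. -/
def empCov {d n : ℕ} (y : Fin n → E d) : Matrix (Fin d) (Fin d) ℝ :=
  (n : ℝ)⁻¹ • ∑ k, Matrix.vecMulVec (y k).ofLp (y k).ofLp -
    Matrix.vecMulVec (empMean y).ofLp (empMean y).ofLp

/-- `g_proj = N(μ_A, Σ_proj)`. -/
def gProj {d r : ℕ} (A : Set (E d)) (dir : Fin r → E d) : Measure (E d) :=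
  multivariateGaussian (condMean A) (projCov (condCov A) dir)

/-- `ĝ_proj = N(μ̂_A, Σ̂_proj)`, computed from the sample `y`. -/
def gProjHat {d r n : ℕ} (y : Fin n → E d) (dir : Fin r → E d) : Measure (E d) :=
  multivariateGaussian (empMean y) (projCov (empCov y) dir)

end

end HighDimIS

/-!
Both claims follow from one estimate that does not depend on the dimension. Let `ℓ = f / g`.

If the weights are truncated at a level `a`, the part below `a` has variance at most `a` under `g`,
and the part above `a` has expectation `f (ℓ > a)`. Hence both functionals of the definition of
efficiency are bounded by a multiple of `√(a / n) + a / n + f (ℓ > a)`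
(`weightDegeneracy_le`, `relativeL1Error_le`), and `g` is efficient as soon as
`f (ℓ > exp t) ≤ C / t` with a constant `C`, outside of events of vanishing probability
(`efficientInHighDimension_of_tail`). By Markov's inequality such a bound holds when the
Kullback-Leibler divergence `∫ log ℓ df` is bounded, the negative part of `log ℓ` being controlled
by `∫ ℓ⁻¹ df = 1`.

For `g = N(m, I + ∑ k, (v k - 1) d_k d_kᵀ)` the two distributions are products in an orthonormal
basis that extends the family, and the divergence is at most
`(∑ k, (v k - 1) ^ 2 + ‖m‖ ^ 2) / (2 c)` if all `v k` are at least `c` (`tail_projected_le`).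
The same coordinates give an explicit version of `ℓ` and a representation of `g` as the image of
the standard Gaussian distribution under an explicit affine map. Both depend measurably on the
parameters, so the functionals are random variables; this includes singular covariances, for which
`ℓ = 0`.

For the exact parameters, conditioning on an event of probability `p` bounds `‖μ_A‖` by
Cauchy-Schwarz, bounds `∑ k, (v k - 1) ^ 2` by Bessel's inequality for the orthogonal functions
`⟪d_k, x⟫ ^ 2 - 1` (`sum_sq_condCov_sub_one_le`), and keeps `v k` above `p ^ 2 / 8`, since the
normal distribution gives small mass to short intervals (`le_variance_inner_condNormal`).

The estimated parameters are close to the exact ones with probability tending to `1`: the mean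
squared errors of the empirical mean and of the `r` empirical second moments along the family are
of order `d / n_g` and `r / n_g`, the latter for each fixed family and hence, by independence, for
the random one (`measure_empirical_bad_le`).
-/

namespace HighDimIS

open scoped NNReal ENNReal RealInnerProductSpace Matrix

/-! ### Importance sampling with truncated weights -/

section Empirical

variable {X : Type*} [MeasurableSpace X] {ν : Measure X} [IsProbabilityMeasure ν]

lemma memLp_sum_eval {n : ℕ} {h : X → ℝ} (hh : MemLp h 2 ν) :
    MemLp (fun y : Fin n → X => ∑ i, h (y i)) 2 (Measure.pi fun _ => ν) :=
  memLp_finsetSum _ fun i _ =>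
    hh.comp_measurePreserving (measurePreserving_eval (fun _ : Fin n => ν) i)

/-- The mean squared error of an empirical mean. -/
lemma integral_sq_empirical_le {n : ℕ} (hn : 0 < n) {h : X → ℝ} (hh : MemLp h 2 ν) :
    ∫ y : Fin n → X, ((n : ℝ)⁻¹ * ∑ i, h (y i) - ∫ x, h x ∂ν) ^ 2 ∂(Measure.pi fun _ => ν)
      ≤ (n : ℝ)⁻¹ * ∫ x, h x ^ 2 ∂ν := by
  have hn' : (n : ℝ) ≠ 0 := by positivity
  have hmean : ∫ y : Fin n → X, ∑ i, h (y i) ∂(Measure.pi fun _ => ν) = n * ∫ x, h x ∂ν := by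
    rw [integral_finsetSum]
    · have : ∀ i : Fin n, ∫ y : Fin n → X, h (y i) ∂(Measure.pi fun _ => ν) = ∫ x, h x ∂ν :=
        fun i => integral_comp_eval (μ := fun _ : Fin n => ν) hh.aestronglyMeasurable
      simp [this]
    · exact fun i _ => integrable_comp_eval (μ := fun _ : Fin n => ν)
        (hh.integrable (by norm_num))
  have hvar := variance_sum_pi (μ := fun _ : Fin n => ν) (X := fun _ => h) (fun _ => hh)
  have hsum : (∑ i : Fin n, fun y : Fin n → X => h (y i)) = fun y => ∑ i, h (y i) := by
    ext y; simp
  rw [hsum, variance_eq_integral (memLp_sum_eval hh).aestronglyMeasurable.aemeasurable,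
    hmean] at hvar
  have hle : Var[h; ν] ≤ ∫ x, h x ^ 2 ∂ν := variance_le_expectation_sq hh.aestronglyMeasurable
  calc _ = ∫ y : Fin n → X, (n : ℝ)⁻¹ ^ 2 * (∑ i, h (y i) - n * ∫ x, h x ∂ν) ^ 2
          ∂(Measure.pi fun _ => ν) := by
        congr with y
        field_simp
    _ = (n : ℝ)⁻¹ ^ 2 * (n * Var[h; ν]) := by
        rw [integral_const_mul, hvar]; simp
    _ = (n : ℝ)⁻¹ * Var[h; ν] := by field_simp
    _ ≤ _ := by gcongr

lemma integrable_sq_empirical {n : ℕ} {h : X → ℝ} (hh : MemLp h 2 ν) (c : ℝ) :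
    Integrable (fun y : Fin n → X => ((n : ℝ)⁻¹ * ∑ i, h (y i) - c) ^ 2)
      (Measure.pi fun _ => ν) :=
  (((memLp_sum_eval hh).const_mul _).sub (memLp_const c)).integrable_sq

lemma integral_abs_le_sqrt {h : X → ℝ} (hh : MemLp h 2 ν) :
    ∫ x, |h x| ∂ν ≤ √(∫ x, h x ^ 2 ∂ν) := by
  apply Real.le_sqrt_of_sq_le
  have h1 : Var[fun x => |h x|; ν] = _ := variance_eq_sub hh.abs
  have h2 := variance_nonneg (fun x => |h x|) ν
  have h3 : ∫ x, |h x| ^ 2 ∂ν = ∫ x, h x ^ 2 ∂ν := by simp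
  simp only [Pi.pow_apply] at h1
  linarith

lemma sq_integral_le {h : X → ℝ} (hh : MemLp h 2 ν) :
    (∫ x, h x ∂ν) ^ 2 ≤ ∫ x, h x ^ 2 ∂ν := by
  have h1 := variance_eq_sub hh
  have h2 := variance_nonneg h ν
  simp only [Pi.pow_apply] at h1
  linarith

end Empirical

section Weights

variable {d : ℕ}

lemma likelihoodRatio_nonneg (f g : Measure (E d)) (x : E d) : 0 ≤ likelihoodRatio f g x :=
  ENNReal.toReal_nonneg

@[fun_prop]
lemma measurable_likelihoodRatio (f g : Measure (E d)) : Measurable (likelihoodRatio f g) :=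
  (Measure.measurable_rnDeriv f g).ennreal_toReal

lemma integrable_likelihoodRatio {f g : Measure (E d)} [IsFiniteMeasure f] :
    Integrable (likelihoodRatio f g) g :=
  Measure.integrable_toReal_rnDeriv

lemma relativeL1Error_nonneg (f : Measure (E d)) (A : Set (E d)) (g : Measure (E d)) (n : ℕ) :
    0 ≤ relativeL1Error f A g n := integral_nonneg fun _ => abs_nonneg _

lemma weightDegeneracy_nonneg (f g : Measure (E d)) (n : ℕ) : 0 ≤ weightDegeneracy f g n :=
  integral_nonneg fun _ => div_nonneg (Real.iSup_nonneg fun _ => likelihoodRatio_nonneg _ _ _)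
    (Finset.sum_nonneg fun _ _ => likelihoodRatio_nonneg _ _ _)

variable {f g : Measure (E d)} [IsProbabilityMeasure f] [IsProbabilityMeasure g]

lemma integral_likelihoodRatio_mul (hfg : f ≪ g) (h : E d → ℝ) :
    ∫ x, likelihoodRatio f g x * h x ∂g = ∫ x, h x ∂f := by
  have := Measure.haveLebesgueDecomposition_of_sigmaFinite f g
  exact integral_toReal_rnDeriv_mul hfg

lemma integral_likelihoodRatio_indicator (hfg : f ≪ g) {s : Set (E d)} (hs : MeasurableSet s) :
    ∫ x, s.indicator (likelihoodRatio f g) x ∂g = f.real s := by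
  have := integral_likelihoodRatio_mul hfg (s.indicator 1)
  rw [integral_indicator_one hs] at this
  rw [← this]
  congr with x
  by_cases hx : x ∈ s <;> simp [hx]

lemma integral_sum_eval {n : ℕ} {h : E d → ℝ} (hh : Integrable h g) :
    ∫ y : Fin n → E d, ∑ i, h (y i) ∂(Measure.pi fun _ => g) = n * ∫ x, h x ∂g := by
  rw [integral_finsetSum]
  · have : ∀ i : Fin n, ∫ y : Fin n → E d, h (y i) ∂(Measure.pi fun _ => g) = ∫ x, h x ∂g :=
      fun i => integral_comp_eval (μ := fun _ : Fin n => g) hh.aestronglyMeasurable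
    simp [this]
  · exact fun i _ => integrable_comp_eval (μ := fun _ : Fin n => g) hh

lemma integrable_sum_eval {n : ℕ} {h : E d → ℝ} (hh : Integrable h g) :
    Integrable (fun y : Fin n → E d => ∑ i, h (y i)) (Measure.pi fun _ => g) :=
  integrable_finsetSum _ fun _ _ => integrable_comp_eval (μ := fun _ : Fin n => g) hh

/-- The `L¹` error of the importance sampling estimator of `f(A)`: weights at most `a` contribute a
variance of at most `a / n`, and those above `a` contribute their `f`-mass twice, once as a bias
and once through their own expectation. -/
lemma integral_abs_weighted_sub_le (hfg : f ≪ g) {A : Set (E d)} (hA : MeasurableSet A) {n : ℕ}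
    (hn : 0 < n) {a : ℝ} (ha : 0 < a) :
    ∫ y : Fin n → E d, |(n : ℝ)⁻¹ * ∑ i, likelihoodRatio f g (y i) * A.indicator 1 (y i)
        - f.real A| ∂(Measure.pi fun _ => g)
      ≤ √(a / n) + 2 * f.real {x | a < likelihoodRatio f g x} := by
  set ℓ := likelihoodRatio f g with hℓ
  have hℓm : Measurable ℓ := measurable_likelihoodRatio f g
  have hℓ0 : ∀ x, 0 ≤ ℓ x := likelihoodRatio_nonneg f g
  set H : Set (E d) := {x | a < ℓ x} with hH
  have hHm : MeasurableSet H := measurableSet_lt measurable_const hℓm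
  set h : E d → ℝ := (A ∩ Hᶜ).indicator ℓ with hh
  set k : E d → ℝ := (A ∩ H).indicator ℓ with hk
  have hh0 : ∀ x, 0 ≤ h x := fun x => Set.indicator_nonneg (fun x _ => hℓ0 x) x
  have hk0 : ∀ x, 0 ≤ k x := fun x => Set.indicator_nonneg (fun x _ => hℓ0 x) x
  have hha : ∀ x, h x ≤ a := by
    intro x
    by_cases hx : x ∈ A ∩ Hᶜ
    · rw [hh, Set.indicator_of_mem hx]
      simpa [hH] using hx.2
    · rw [hh, Set.indicator_of_notMem hx]; exact ha.le
  have hhm : Measurable h := hℓm.indicator (hA.inter hHm.compl)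
  have hhL : MemLp h 2 g := MemLp.of_bound hhm.aestronglyMeasurable a
    (ae_of_all _ fun x => by rw [Real.norm_eq_abs, abs_of_nonneg (hh0 x)]; exact hha x)
  have hkI : Integrable k g := integrable_likelihoodRatio.indicator (hA.inter hHm)
  have hIh : ∫ x, h x ∂g = f.real (A ∩ Hᶜ) :=
    integral_likelihoodRatio_indicator hfg (hA.inter hHm.compl)
  have hIk : ∫ x, k x ∂g = f.real (A ∩ H) :=
    integral_likelihoodRatio_indicator hfg (hA.inter hHm)
  have hsplit : f.real A = f.real (A ∩ Hᶜ) + f.real (A ∩ H) := by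
    rw [← measureReal_inter_add_sdiff (s := A) hHm, Set.sdiff_eq]; ring
  have hAH : f.real (A ∩ H) ≤ f.real H := measureReal_mono Set.inter_subset_right
  have hpt : ∀ x, ℓ x * A.indicator 1 x = h x + k x := by
    intro x
    by_cases hx : x ∈ A <;> by_cases hx' : x ∈ H <;> simp [hh, hk, hx, hx']
  have hsq : ∫ x, h x ^ 2 ∂g ≤ a := by
    calc ∫ x, h x ^ 2 ∂g ≤ ∫ x, a * h x ∂g := by
          apply integral_mono hhL.integrable_sq ((hhL.integrable (by norm_num)).const_mul a)
          intro x
          have := hha x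
          have := hh0 x
          simp only
          nlinarith
      _ = a * f.real (A ∩ Hᶜ) := by rw [integral_const_mul, hIh]
      _ ≤ a * 1 := by gcongr; exact measureReal_le_one
      _ = a := mul_one a
  have hnI : (0 : ℝ) ≤ (n : ℝ)⁻¹ := by positivity
  have hL2 : MemLp (fun y : Fin n → E d => (n : ℝ)⁻¹ * ∑ i, h (y i) - ∫ x, h x ∂g) 2
      (Measure.pi fun _ => g) := ((memLp_sum_eval hhL).const_mul _).sub (memLp_const _)
  have hkc : Integrable (fun y : Fin n → E d => (n : ℝ)⁻¹ * ∑ i, k (y i) + f.real (A ∩ H))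
      (Measure.pi fun _ => g) := ((integrable_sum_eval hkI).const_mul _).add (integrable_const _)
  calc _ ≤ ∫ y : Fin n → E d, (|(n : ℝ)⁻¹ * ∑ i, h (y i) - ∫ x, h x ∂g|
          + ((n : ℝ)⁻¹ * ∑ i, k (y i) + f.real (A ∩ H))) ∂(Measure.pi fun _ => g) := by
        apply integral_mono_of_nonneg (ae_of_all _ fun y => abs_nonneg _)
        · exact (hL2.integrable (by norm_num)).abs.add hkc
        refine ae_of_all _ fun y => ?_
        have hks : 0 ≤ (n : ℝ)⁻¹ * ∑ i, k (y i) :=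
          mul_nonneg hnI (Finset.sum_nonneg fun i _ => hk0 _)
        simp only [hpt, Finset.sum_add_distrib, mul_add, hIh, hsplit]
        have hp : 0 ≤ f.real (A ∩ H) := measureReal_nonneg
        rw [abs_le]
        constructor
        · linarith [neg_abs_le ((n : ℝ)⁻¹ * ∑ i, h (y i) - f.real (A ∩ Hᶜ))]
        · linarith [le_abs_self ((n : ℝ)⁻¹ * ∑ i, h (y i) - f.real (A ∩ Hᶜ))]
    _ = ∫ y : Fin n → E d, |(n : ℝ)⁻¹ * ∑ i, h (y i) - ∫ x, h x ∂g| ∂(Measure.pi fun _ => g)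
        + (f.real (A ∩ H) + f.real (A ∩ H)) := by
        rw [integral_add (hL2.integrable (by norm_num)).abs hkc,
          integral_add ((integrable_sum_eval hkI).const_mul _) (integrable_const _),
          integral_const_mul, integral_sum_eval hkI, hIk]
        have : (n : ℝ) ≠ 0 := by positivity
        simp [this]
    _ ≤ √(a / n) + (f.real H + f.real H) := by
        gcongr
        refine (integral_abs_le_sqrt hL2).trans (Real.sqrt_le_sqrt ?_)
        refine (integral_sq_empirical_le hn hhL).trans ?_
        rw [div_eq_inv_mul]
        gcongr
    _ = _ := by ring

lemma relativeL1Error_le (hfg : f ≪ g) {A : Set (E d)} (hA : MeasurableSet A)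
    (hp : 0 < f.real A) {n : ℕ} (hn : 0 < n) {a : ℝ} (ha : 0 < a) :
    relativeL1Error f A g n
      ≤ (f.real A)⁻¹ * (√(a / n) + 2 * f.real {x | a < likelihoodRatio f g x}) := by
  rw [relativeL1Error]
  calc _ = (f.real A)⁻¹ * ∫ y : Fin n → E d, |(n : ℝ)⁻¹ *
          ∑ i, likelihoodRatio f g (y i) * A.indicator 1 (y i) - f.real A|
          ∂(Measure.pi fun _ => g) := by
        rw [← integral_const_mul]
        congr with y
        conv_rhs => rw [← abs_of_pos (inv_pos.2 hp), ← abs_mul]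
        congr 1
        have : (n : ℝ) ≠ 0 := by positivity
        field_simp
    _ ≤ _ := by
        gcongr
        exact integral_abs_weighted_sub_le hfg hA hn ha

/-- The largest weight is at most `a` plus the sum of the weights above `a`; where the sum of all
weights is below `n / 2`, its distance to `n` bounds the ratio instead. -/
lemma weightDegeneracy_le (hfg : f ≪ g) {n : ℕ} (hn : 0 < n) {a : ℝ} (ha : 0 < a) :
    weightDegeneracy f g n ≤ 2 * (a / n) + 2 * f.real {x | a < likelihoodRatio f g x}
      + 2 * (√(a / n) + 2 * f.real {x | a < likelihoodRatio f g x}) := by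
  have hmain := integral_abs_weighted_sub_le hfg MeasurableSet.univ hn ha
  simp only [Set.indicator_univ, Pi.one_apply, mul_one, probReal_univ] at hmain
  rw [weightDegeneracy]
  set ℓ := likelihoodRatio f g with hℓ
  have hℓm : Measurable ℓ := measurable_likelihoodRatio f g
  have hℓ0 : ∀ x, 0 ≤ ℓ x := likelihoodRatio_nonneg f g
  set H : Set (E d) := {x | a < ℓ x} with hH
  have hHm : MeasurableSet H := measurableSet_lt measurable_const hℓm
  set k : E d → ℝ := H.indicator ℓ with hk
  have hk0 : ∀ x, 0 ≤ k x := fun x => Set.indicator_nonneg (fun x _ => hℓ0 x) x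
  have hkI : Integrable k g := integrable_likelihoodRatio.indicator hHm
  have hIk : ∫ x, k x ∂g = f.real H := integral_likelihoodRatio_indicator hfg hHm
  have hn' : (0 : ℝ) < n := by positivity
  have hI1 : Integrable (fun y : Fin n → E d => 2 * (a / n) + 2 * ((n : ℝ)⁻¹ * ∑ i, k (y i)))
      (Measure.pi fun _ => g) :=
    (integrable_const _).add (((integrable_sum_eval hkI).const_mul _).const_mul _)
  have hI2 : Integrable (fun y : Fin n → E d => 2 * |(n : ℝ)⁻¹ * ∑ i, ℓ (y i) - 1|)
      (Measure.pi fun _ => g) :=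
    ((((integrable_sum_eval integrable_likelihoodRatio).const_mul _).sub
      (integrable_const _)).abs).const_mul _
  have : Nonempty (Fin n) := ⟨⟨0, hn⟩⟩
  calc _ ≤ ∫ y : Fin n → E d, (2 * (a / n) + 2 * ((n : ℝ)⁻¹ * ∑ i, k (y i))
          + 2 * |(n : ℝ)⁻¹ * ∑ i, ℓ (y i) - 1|) ∂(Measure.pi fun _ => g) := by
        apply integral_mono_of_nonneg _ (hI1.add hI2)
        · refine ae_of_all _ fun y => ?_
          have hS0 : 0 ≤ ∑ i, ℓ (y i) := Finset.sum_nonneg fun i _ => hℓ0 _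
          have hks : 0 ≤ ∑ i, k (y i) := Finset.sum_nonneg fun i _ => hk0 _
          have hM : (⨆ i, ℓ (y i)) ≤ a + ∑ i, k (y i) := by
            refine ciSup_le fun i => ?_
            by_cases hi : y i ∈ H
            · have h1 : k (y i) ≤ ∑ i, k (y i) :=
                Finset.single_le_sum (f := fun i => k (y i)) (fun j _ => hk0 _)
                  (Finset.mem_univ i)
              have h2 : k (y i) = ℓ (y i) := Set.indicator_of_mem hi _
              linarith
            · have : ℓ (y i) ≤ a := by simpa [hH] using hi
              linarith
          have hM1 : (⨆ i, ℓ (y i)) ≤ ∑ i, ℓ (y i) :=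
            ciSup_le fun i => Finset.single_le_sum (f := fun i => ℓ (y i)) (fun j _ => hℓ0 _)
              (Finset.mem_univ i)
          have hab : 0 ≤ |(n : ℝ)⁻¹ * ∑ i, ℓ (y i) - 1| := abs_nonneg _
          by_cases hS : (n : ℝ) / 2 ≤ ∑ i, ℓ (y i)
          · have hSpos : 0 < ∑ i, ℓ (y i) := lt_of_lt_of_le (by positivity) hS
            have : (⨆ i, ℓ (y i)) / ∑ i, ℓ (y i) ≤ (a + ∑ i, k (y i)) / (n / 2) := by
              gcongr
            have h2 : (a + ∑ i, k (y i)) / (n / 2)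
                = 2 * (a / n) + 2 * ((n : ℝ)⁻¹ * ∑ i, k (y i)) := by field_simp
            simp only [Pi.add_apply]
            linarith
          · have h1 : (⨆ i, ℓ (y i)) / ∑ i, ℓ (y i) ≤ 1 := div_le_one_of_le₀ hM1 hS0
            have h2 : (n : ℝ)⁻¹ * ∑ i, ℓ (y i) ≤ 1 / 2 := by
              rw [inv_mul_le_iff₀ hn']
              linarith
            have h3 := neg_abs_le ((n : ℝ)⁻¹ * ∑ i, ℓ (y i) - 1)
            have h4 : 0 ≤ 2 * (a / n) + 2 * ((n : ℝ)⁻¹ * ∑ i, k (y i)) := by positivity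
            simp only [Pi.add_apply]
            linarith
        · refine ae_of_all _ fun y => ?_
          exact div_nonneg (Real.iSup_nonneg fun i => hℓ0 _)
            (Finset.sum_nonneg fun i _ => hℓ0 _)
    _ = 2 * (a / n) + 2 * f.real H
        + 2 * ∫ y : Fin n → E d, |(n : ℝ)⁻¹ * ∑ i, ℓ (y i) - 1| ∂(Measure.pi fun _ => g) := by
        rw [integral_add hI1 hI2, integral_add (integrable_const _)
          (((integrable_sum_eval hkI).const_mul _).const_mul _)]
        simp only [integral_const_mul]
        rw [integral_sum_eval hkI, hIk]
        simp [hn'.ne']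
    _ ≤ _ := by gcongr

end Weights

/-! ### From tails of the log-likelihood ratio to efficiency -/

section Convergence

variable {Ω : ℕ → Type*} [∀ d, MeasurableSpace (Ω d)]
  {P : ∀ d, Measure (Ω d)} [∀ d, IsProbabilityMeasure (P d)]

/-- Convergence in probability to `0` implies convergence in distribution, also when the random
variables live on different probability spaces. -/
lemma tendstoZeroInDistribution_of_measure {Z : ∀ d, Ω d → ℝ}
    (hZ : ∀ d, AEMeasurable (Z d) (P d))
    (h : ∀ ε > 0, Tendsto (fun d => P d {ω | ε ≤ |Z d ω|}) atTop (𝓝 0)) :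
    TendstoZeroInDistribution P Z where
  forall_aemeasurable := hZ
  tendsto := by
    refine tendsto_of_forall_isClosed_limsup_le' fun F hF => ?_
    simp only [ProbabilityMeasure.coe_mk, Measure.map_const, measure_univ, one_smul]
    by_cases h0 : (0 : ℝ) ∈ F
    · rw [Measure.dirac_apply_of_mem h0]
      refine limsup_le_of_le (h := Eventually.of_forall fun d => ?_)
      have := Measure.isProbabilityMeasure_map (hZ d)
      exact prob_le_one
    · obtain ⟨ε, hε, hball⟩ := Metric.isOpen_iff.1 hF.isOpen_compl 0 h0
      have hlim : Tendsto (fun d => (P d).map (Z d) F) atTop (𝓝 0) := by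
        refine tendsto_of_tendsto_of_tendsto_of_le_of_le tendsto_const_nhds (h ε hε)
          (fun _ => zero_le) fun d => ?_
        rw [Measure.map_apply_of_aemeasurable (hZ d) hF.measurableSet]
        refine measure_mono fun ω hω => ?_
        by_contra hlt
        exact hball (by simpa using hlt) hω
      rw [hlim.limsup_eq]
      exact zero_le

/-- If the deviation probabilities of `log (f / g)` under `f` are, outside of events of vanishing
probability, bounded by `C / t` with a constant that does not depend on the dimension, then `g` is
efficient: truncation at a fixed large level `exp t` makes the tail contribution small, and the
remaining terms vanish as the sample size grows. -/
lemma efficientInHighDimension_of_tail {f : ∀ d, Measure (E d)}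
    [∀ d, IsProbabilityMeasure (f d)] {A : ∀ d, Set (E d)} (hA : ∀ d, MeasurableSet (A d))
    {p₀ : ℝ} (hp₀ : 0 < p₀) (hp : ∀ d, p₀ ≤ (f d).real (A d))
    {g : ∀ d, Ω d → Measure (E d)} [∀ d ω, IsProbabilityMeasure (g d ω)]
    (hw : ∀ d n, AEMeasurable (fun ω => weightDegeneracy (f d) (g d ω) n) (P d))
    (he : ∀ d n, AEMeasurable (fun ω => relativeL1Error (f d) (A d) (g d ω) n) (P d))
    {B : ∀ d, Set (Ω d)} (hB : Tendsto (fun d => P d (B d)) atTop (𝓝 0)) {C : ℝ}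
    (hgood : ∀ d, ∀ ω ∉ B d, f d ≪ g d ω ∧ ∀ t > 0,
      (f d).real {x | Real.exp t < likelihoodRatio (f d) (g d ω) x} ≤ C / t) :
    EfficientInHighDimension P f A g := by
  intro np hnp
  -- A bound of the form `F t n`, whose limit in `n` tends to `0` as `t → ∞`, is enough.
  have key : ∀ (Z : ∀ d, Ω d → ℝ) (F : ℝ → ℕ → ℝ) (G : ℝ → ℝ), (∀ d, AEMeasurable (Z d) (P d)) →
      (∀ t > 0, Tendsto (F t) atTop (𝓝 (G t))) → Tendsto G atTop (𝓝 0) →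
      (∀ d ω, 0 ≤ Z d ω) → (∀ d, 0 < np d → ∀ ω ∉ B d, ∀ t > 0, Z d ω ≤ F t (np d)) →
      TendstoZeroInDistribution P Z := by
    intro Z F G hZ hF hG hZ0 hZF
    refine tendstoZeroInDistribution_of_measure hZ fun ε hε => ?_
    obtain ⟨t, ht, ht0⟩ := ((hG.eventually_lt_const hε).and (eventually_gt_atTop 0)).exists
    have hev : ∀ᶠ d in atTop, F t (np d) < ε :=
      ((hF t ht0).comp hnp).eventually_lt_const ht
    refine tendsto_of_tendsto_of_tendsto_of_le_of_le' tendsto_const_nhds hB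
      (Eventually.of_forall fun _ => zero_le) ?_
    filter_upwards [hev, hnp.eventually_gt_atTop 0] with d hd hn
    refine measure_mono fun ω hω => ?_
    by_contra hωB
    have h1 := hZF d hn ω hωB t ht0
    simp only [Set.mem_ofPred_eq, abs_of_nonneg (hZ0 d ω)] at hω
    linarith
  have hdiv : ∀ t : ℝ, Tendsto (fun n : ℕ => Real.exp t / n) atTop (𝓝 0) := fun t =>
    tendsto_const_div_atTop_nhds_zero_nat _
  have hsqrt : ∀ t : ℝ, Tendsto (fun n : ℕ => √(Real.exp t / n)) atTop (𝓝 0) := fun t => by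
    simpa using (hdiv t).sqrt
  have hC : Tendsto (fun t : ℝ => C / t) atTop (𝓝 0) := tendsto_const_nhds.div_atTop tendsto_id
  constructor
  · refine key _ (fun t n => 2 * (Real.exp t / n) + 2 * (C / t)
      + 2 * (√(Real.exp t / n) + 2 * (C / t)))
      (fun t => 2 * 0 + 2 * (C / t) + 2 * (0 + 2 * (C / t))) (fun d => hw d _) ?_ ?_
      (fun d ω => weightDegeneracy_nonneg _ _ _) ?_
    · intro t _
      exact (((hdiv t).const_mul 2).add_const _).add (((hsqrt t).add_const _).const_mul 2)
    · simpa using ((hC.const_mul 2).add ((hC.const_mul 2).const_mul 2))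
    · intro d hn ω hω t ht
      obtain ⟨hac, htail⟩ := hgood d ω hω
      have := htail t ht
      refine (weightDegeneracy_le hac hn (Real.exp_pos t)).trans ?_
      gcongr
  · refine key _ (fun t n => p₀⁻¹ * (√(Real.exp t / n) + 2 * (C / t)))
      (fun t => p₀⁻¹ * (0 + 2 * (C / t))) (fun d => he d _) ?_ ?_
      (fun d ω => relativeL1Error_nonneg _ _ _ _) ?_
    · intro t _
      exact ((hsqrt t).add_const _).const_mul _
    · simpa using ((hC.const_mul 2).const_mul p₀⁻¹)
    · intro d hn ω hω t ht
      obtain ⟨hac, htail⟩ := hgood d ω hω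
      have h1 := htail t ht
      refine (relativeL1Error_le hac (hA d) (hp₀.trans_le (hp d)) hn (Real.exp_pos t)).trans ?_
      have h2 := hp d
      gcongr

end Convergence

/-! ### Gaussian distributions with a diagonal covariance -/

section Product

/-- A product of densities is the density of the product measure. -/
lemma pi_withDensity {ι : Type*} [Fintype ι] {X : ι → Type*} [∀ i, MeasurableSpace (X i)]
    (μ : ∀ i, Measure (X i)) [∀ i, IsProbabilityMeasure (μ i)] {ρ : ∀ i, X i → ℝ≥0∞}
    (hρ : ∀ i, Measurable (ρ i)) [∀ i, IsProbabilityMeasure ((μ i).withDensity (ρ i))] :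
    Measure.pi (fun i => (μ i).withDensity (ρ i))
      = (Measure.pi μ).withDensity fun z => ∏ i, ρ i (z i) := by
  refine Measure.pi_eq fun s hs => ?_
  rw [withDensity_apply _ (MeasurableSet.univ_pi hs),
    ← lintegral_indicator (MeasurableSet.univ_pi hs)]
  have h1 : ∀ z : ∀ i, X i, (Set.univ.pi s).indicator (fun z => ∏ i, ρ i (z i)) z
      = ∏ i, (s i).indicator (ρ i) (z i) := by
    intro z
    by_cases hz : z ∈ Set.univ.pi s
    · rw [Set.indicator_of_mem hz]
      exact Finset.prod_congr rfl fun i _ => (Set.indicator_of_mem (hz i (Set.mem_univ i)) _).symm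
    · rw [Set.indicator_of_notMem hz]
      simp only [Set.mem_pi, Set.mem_univ, true_imp_iff, not_forall] at hz
      obtain ⟨i, hi⟩ := hz
      exact (Finset.prod_eq_zero (Finset.mem_univ i) (Set.indicator_of_notMem hi _)).symm
  simp only [h1]
  rw [lintegral_prod_eq_prod_lintegral_of_indepFun Finset.univ
    (fun i (z : ∀ i, X i) => (s i).indicator (ρ i) (z i))
    (iIndepFun_pi fun i => ((hρ i).indicator (hs i)).aemeasurable)
    (fun i => ((hρ i).indicator (hs i)).comp (measurable_pi_apply i))]
  refine Finset.prod_congr rfl fun i _ => ?_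
  rw [(measurePreserving_eval μ i).lintegral_comp ((hρ i).indicator (hs i)),
    lintegral_indicator (hs i), withDensity_apply _ (hs i)]

lemma map_withDensity_comp {X Y : Type*} [MeasurableSpace X] [MeasurableSpace Y] (μ : Measure X)
    {φ : X → Y} (hφ : Measurable φ) {ρ : Y → ℝ≥0∞} (hρ : Measurable ρ) :
    (μ.withDensity (ρ ∘ φ)).map φ = (μ.map φ).withDensity ρ := by
  ext s hs
  rw [Measure.map_apply hφ hs, withDensity_apply _ (hφ hs), withDensity_apply _ hs,
    setLIntegral_map hs hρ hφ]
  rfl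

end Product

section OneDim

/-- The ratio of the densities of `N(0, 1)` and `N(m, w)`. It is `0` for `w = 0`, in agreement
with the Radon-Nikodym derivative. -/
noncomputable def gaussRatio (m : ℝ) (w : ℝ≥0) (x : ℝ) : ℝ :=
  √w * Real.exp (((x - m) ^ 2 / w - x ^ 2) / 2)

lemma gaussRatio_nonneg (m : ℝ) (w : ℝ≥0) (x : ℝ) : 0 ≤ gaussRatio m w x := by
  unfold gaussRatio; positivity

lemma gaussRatio_pos (m : ℝ) {w : ℝ≥0} (hw : w ≠ 0) (x : ℝ) : 0 < gaussRatio m w x := by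
  have : (0 : ℝ) < w := by positivity
  unfold gaussRatio; positivity

@[fun_prop]
lemma measurable_gaussRatio (m : ℝ) (w : ℝ≥0) : Measurable (gaussRatio m w) := by
  unfold gaussRatio; fun_prop

lemma gaussianReal_eq_withDensity (m : ℝ) {w : ℝ≥0} (hw : w ≠ 0) :
    (gaussianReal m w).withDensity (fun x => ENNReal.ofReal (gaussRatio m w x))
      = gaussianReal 0 1 := by
  rw [gaussianReal_of_var_ne_zero _ hw, gaussianReal_of_var_ne_zero _ one_ne_zero,
    ← withDensity_mul _ (measurable_gaussianPDF _ _) (by fun_prop)]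
  congr with x
  have hw' : (0 : ℝ) < w := by positivity
  rw [Pi.mul_apply, gaussianPDF, gaussianPDF, ← ENNReal.ofReal_mul (gaussianPDFReal_nonneg _ _ _)]
  congr 1
  rw [gaussianPDFReal, gaussianPDFReal, gaussRatio, mul_mul_mul_comm, ← Real.exp_add]
  congr 1
  · rw [Real.sqrt_mul (by positivity)]
    have : √(w : ℝ) ≠ 0 := by positivity
    field_simp
    simp
  · congr 1
    simp only [NNReal.coe_one, sub_zero, mul_one]
    field_simp
    ring

lemma log_gaussRatio (m : ℝ) {w : ℝ≥0} (hw : w ≠ 0) (x : ℝ) :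
    Real.log (gaussRatio m w x) = (Real.log w + ((x - m) ^ 2 / w - x ^ 2)) / 2 := by
  have hw' : (0 : ℝ) < w := by positivity
  rw [gaussRatio, Real.log_mul (by positivity) (by positivity), Real.log_exp,
    Real.log_sqrt hw'.le]
  ring

lemma integral_sq_gaussianReal : ∫ x, x ^ 2 ∂(gaussianReal 0 1) = 1 := by
  have h := variance_eq_sub (μ := gaussianReal 0 1) (X := id) (memLp_id_gaussianReal 2)
  rw [variance_id_gaussianReal] at h
  simpa using h.symm

lemma integrable_id_gaussianReal : Integrable (fun x : ℝ => x) (gaussianReal 0 1) :=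
  (memLp_id_gaussianReal 1).integrable le_rfl

lemma integrable_sq_gaussianReal : Integrable (fun x : ℝ => x ^ 2) (gaussianReal 0 1) :=
  (memLp_id_gaussianReal 2).integrable_sq

lemma log_gaussRatio_expand (m : ℝ) {w : ℝ≥0} (hw : w ≠ 0) (x : ℝ) :
    Real.log (gaussRatio m w x) = ((w : ℝ)⁻¹ - 1) / 2 * x ^ 2 + -(m / w) * x
      + (Real.log w + m ^ 2 / w) / 2 := by
  have hw' : (0 : ℝ) < w := by positivity
  rw [log_gaussRatio m hw]
  field_simp
  ring

lemma integrable_log_gaussRatio (m : ℝ) {w : ℝ≥0} (hw : w ≠ 0) :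
    Integrable (fun x => Real.log (gaussRatio m w x)) (gaussianReal 0 1) := by
  simp only [log_gaussRatio_expand m hw]
  exact ((integrable_sq_gaussianReal.const_mul _).add (integrable_id_gaussianReal.const_mul _)).add
    (integrable_const _)

/-- The Kullback-Leibler divergence of `N(0, 1)` from `N(m, w)` is of second order at
`(m, w) = (0, 1)`. -/
lemma integral_log_gaussRatio_le (m : ℝ) {w : ℝ≥0} {c : ℝ} (hc : 0 < c) (hw : c ≤ w) :
    ∫ x, Real.log (gaussRatio m w x) ∂(gaussianReal 0 1)
      ≤ (((w : ℝ) - 1) ^ 2 + m ^ 2) / (2 * c) := by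
  have hw' : (0 : ℝ) < w := hc.trans_le hw
  have hw0 : w ≠ 0 := by rintro rfl; simp at hw'
  have hI : ∫ x, Real.log (gaussRatio m w x) ∂(gaussianReal 0 1)
      = (((w : ℝ)⁻¹ - 1) + Real.log w + m ^ 2 / w) / 2 := by
    simp only [log_gaussRatio_expand m hw0]
    have h12 : Integrable (fun x : ℝ => ((w : ℝ)⁻¹ - 1) / 2 * x ^ 2 + -(m / w) * x)
        (gaussianReal 0 1) :=
      (integrable_sq_gaussianReal.const_mul _).add (integrable_id_gaussianReal.const_mul _)
    rw [integral_add h12 (integrable_const _),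
      integral_add (integrable_sq_gaussianReal.const_mul _)
      (integrable_id_gaussianReal.const_mul _), integral_const_mul, integral_const_mul,
      integral_sq_gaussianReal, integral_id_gaussianReal]
    simp
    ring
  rw [hI]
  have hlog := Real.log_le_sub_one_of_pos hw'
  calc (((w : ℝ)⁻¹ - 1) + Real.log w + m ^ 2 / w) / 2
      ≤ (((w : ℝ)⁻¹ - 1) + (w - 1) + m ^ 2 / w) / 2 := by gcongr
    _ = (((w : ℝ) - 1) ^ 2 + m ^ 2) / (2 * w) := by field_simp; ring
    _ ≤ _ := by gcongr

end OneDim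

section Diagonal

variable {d : ℕ}

/-- The Gaussian distribution on `ℝ^d` with mean `m` and with independent coordinates of variances
`w i` in the orthonormal basis `b`. -/
noncomputable def diagGaussian (b : OrthonormalBasis (Fin d) ℝ (E d)) (m : E d)
    (w : Fin d → ℝ≥0) : Measure (E d) :=
  (Measure.pi fun i => gaussianReal ⟪b i, m⟫ (w i)).map fun z => ∑ i, z i • b i

variable (b : OrthonormalBasis (Fin d) ℝ (E d)) (m : E d) (w : Fin d → ℝ≥0)

lemma measurable_sum_smul_basis :
    Measurable fun z : Fin d → ℝ => ∑ i, z i • b i := by fun_prop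

lemma inner_basis_sum_smul (z : Fin d → ℝ) (j : Fin d) : ⟪b j, ∑ i, z i • b i⟫ = z j := by
  simp [inner_sum, real_inner_smul_right, b.inner_eq_ite]

instance : IsProbabilityMeasure (diagGaussian b m w) :=
  Measure.isProbabilityMeasure_map (measurable_sum_smul_basis b).aemeasurable

/-- The density of the standard Gaussian distribution with respect to `diagGaussian b m w`
when all variances are positive, and `0` otherwise. -/
noncomputable def diagRatio (x : E d) : ℝ := ∏ i, gaussRatio ⟪b i, m⟫ (w i) ⟪b i, x⟫

lemma measurable_diagRatio : Measurable (diagRatio b m w) := by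
  unfold diagRatio
  exact Finset.measurable_prod _ fun i _ =>
    (measurable_gaussRatio _ _).comp (by fun_prop)

lemma diagRatio_nonneg (x : E d) : 0 ≤ diagRatio b m w x :=
  Finset.prod_nonneg fun _ _ => gaussRatio_nonneg _ _ _

variable {w}

lemma diagRatio_pos (hw : ∀ i, w i ≠ 0) (x : E d) : 0 < diagRatio b m w x :=
  Finset.prod_pos fun i _ => gaussRatio_pos _ (hw i) _

lemma stdNormal_eq_withDensity (hw : ∀ i, w i ≠ 0) :
    stdNormal d
      = (diagGaussian b m w).withDensity fun x => ENNReal.ofReal (diagRatio b m w x) := by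
  have hρ : ∀ i, Measurable fun x => ENNReal.ofReal (gaussRatio ⟪b i, m⟫ (w i) x) :=
    fun i => by fun_prop
  have hγ : ∀ i, (gaussianReal ⟪b i, m⟫ (w i)).withDensity
      (fun x => ENNReal.ofReal (gaussRatio ⟪b i, m⟫ (w i) x)) = gaussianReal 0 1 :=
    fun i => gaussianReal_eq_withDensity _ (hw i)
  have : ∀ i, IsProbabilityMeasure ((gaussianReal ⟪b i, m⟫ (w i)).withDensity
      (fun x => ENNReal.ofReal (gaussRatio ⟪b i, m⟫ (w i) x))) := fun i => by
    rw [hγ]; infer_instance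
  have hpi := pi_withDensity (fun i => gaussianReal ⟪b i, m⟫ (w i)) hρ
  simp only [hγ] at hpi
  rw [diagGaussian, ← map_withDensity_comp _ (measurable_sum_smul_basis b)
    (measurable_diagRatio b m w).ennreal_ofReal, stdNormal,
    stdGaussian_eq_map_pi_orthonormalBasis b, hpi]
  congr 2
  ext z
  simp only [Function.comp_apply, diagRatio, inner_basis_sum_smul]
  rw [ENNReal.ofReal_prod_of_nonneg fun _ _ => gaussRatio_nonneg _ _ _]

lemma absolutelyContinuous_diagGaussian (hw : ∀ i, w i ≠ 0) :
    stdNormal d ≪ diagGaussian b m w := by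
  rw [stdNormal_eq_withDensity b m hw]
  exact withDensity_absolutelyContinuous _ _

lemma map_inner_stdNormal (u : E d) :
    (stdNormal d).map (fun x => ⟪u, x⟫) = gaussianReal 0 (‖u‖₊ ^ 2) := by
  have h := IsGaussian.map_eq_gaussianReal (μ := stdNormal d) (innerSL ℝ u)
  rw [integral_strongDual_stdGaussian, variance_dual_stdGaussian] at h
  simp only [innerSL_apply_norm] at h
  have h2 : (‖u‖ ^ 2).toNNReal = ‖u‖₊ ^ 2 := by
    rw [Real.toNNReal_pow (norm_nonneg u), norm_toNNReal]
  rw [h2] at h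
  exact h

lemma measurePreserving_inner_stdNormal {u : E d} (hu : ‖u‖ = 1) :
    MeasurePreserving (fun x => ⟪u, x⟫) (stdNormal d) (gaussianReal 0 1) where
  measurable := by fun_prop
  map_eq := by
    rw [map_inner_stdNormal]
    have : ‖u‖₊ = 1 := by ext; simpa using hu
    simp [this]

/-- If one of the variances vanishes, `diagGaussian b m w` charges a hyperplane, which is a null
set of the standard Gaussian distribution. -/
lemma mutuallySingular_diagGaussian {j : Fin d} (hj : w j = 0) :
    stdNormal d ⟂ₘ diagGaussian b m w := by
  have hm : Measurable fun x : E d => ⟪b j, x⟫ := by fun_prop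
  refine ⟨(fun x => ⟪b j, x⟫) ⁻¹' {⟪b j, m⟫}, hm (measurableSet_singleton _), ?_, ?_⟩
  · have := nullSingletonClass_gaussianReal (μ := 0) (v := 1) one_ne_zero
    rw [(measurePreserving_inner_stdNormal (b.norm_eq_one j)).measure_preimage
      (measurableSet_singleton _).nullMeasurableSet]
    exact measure_singleton _
  · have hs : MeasurableSet ({⟪b j, m⟫}ᶜ : Set ℝ) := (measurableSet_singleton _).compl
    have hpre : (fun z : Fin d → ℝ => ∑ i, z i • b i) ⁻¹'
        ((fun x => ⟪b j, x⟫) ⁻¹' {⟪b j, m⟫})ᶜ = (fun z : Fin d → ℝ => z j) ⁻¹' {⟪b j, m⟫}ᶜ := by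
      ext z
      simp [inner_basis_sum_smul]
    rw [diagGaussian, Measure.map_apply (measurable_sum_smul_basis b)
      (hm (measurableSet_singleton _)).compl, hpre,
      (measurePreserving_eval (fun i => gaussianReal ⟪b i, m⟫ (w i)) j).measure_preimage
        hs.nullMeasurableSet, hj, gaussianReal_zero_var]
    simp

lemma likelihoodRatio_diagGaussian :
    likelihoodRatio (stdNormal d) (diagGaussian b m w) =ᵐ[diagGaussian b m w]
      diagRatio b m w := by
  by_cases hw : ∀ i, w i ≠ 0
  · have h := Measure.rnDeriv_withDensity (diagGaussian b m w)
      (measurable_diagRatio b m w).ennreal_ofReal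
    rw [← stdNormal_eq_withDensity b m hw] at h
    filter_upwards [h] with x hx
    rw [likelihoodRatio, hx, ENNReal.toReal_ofReal (diagRatio_nonneg b m w x)]
  · push Not at hw
    obtain ⟨j, hj⟩ := hw
    have hs := (mutuallySingular_diagGaussian b m hj).rnDeriv_ae_eq_zero
    filter_upwards [hs] with x hx
    rw [likelihoodRatio, hx, diagRatio]
    symm
    simpa using Finset.prod_eq_zero (Finset.mem_univ j) (by simp [hj, gaussRatio])

lemma integrable_log_diagRatio (hw : ∀ i, w i ≠ 0) :
    Integrable (fun x => Real.log (diagRatio b m w x)) (stdNormal d) := by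
  have : ∀ x, Real.log (diagRatio b m w x)
      = ∑ i, Real.log (gaussRatio ⟪b i, m⟫ (w i) ⟪b i, x⟫) := fun x =>
    Real.log_prod fun i _ => (gaussRatio_pos _ (hw i) _).ne'
  simp only [this]
  refine integrable_finsetSum _ fun i _ => ?_
  exact (measurePreserving_inner_stdNormal (b.norm_eq_one i)).integrable_comp_of_integrable
    (integrable_log_gaussRatio _ (hw i))

lemma integral_log_diagRatio_le {c : ℝ} (hc : 0 < c) (hw : ∀ i, c ≤ w i) :
    ∫ x, Real.log (diagRatio b m w x) ∂(stdNormal d)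
      ≤ (∑ i, ((w i : ℝ) - 1) ^ 2 + ‖m‖ ^ 2) / (2 * c) := by
  have hw0 : ∀ i, w i ≠ 0 := fun i h => by
    have := hc.trans_le (hw i); simp [h] at this
  have hlog : ∀ x, Real.log (diagRatio b m w x)
      = ∑ i, Real.log (gaussRatio ⟪b i, m⟫ (w i) ⟪b i, x⟫) := fun x =>
    Real.log_prod fun i _ => (gaussRatio_pos _ (hw0 i) _).ne'
  simp only [hlog]
  have hint : ∀ i, Integrable (fun x => Real.log (gaussRatio ⟪b i, m⟫ (w i) ⟪b i, x⟫))
      (stdNormal d) := fun i => (measurePreserving_inner_stdNormal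
    (b.norm_eq_one i)).integrable_comp_of_integrable (integrable_log_gaussRatio _ (hw0 i))
  rw [integral_finsetSum _ fun i _ => hint i]
  have hi : ∀ i, ∫ x, Real.log (gaussRatio ⟪b i, m⟫ (w i) ⟪b i, x⟫) ∂(stdNormal d)
      ≤ (((w i : ℝ) - 1) ^ 2 + ⟪b i, m⟫ ^ 2) / (2 * c) := fun i => by
    have hmp := measurePreserving_inner_stdNormal (b.norm_eq_one i)
    have h := integral_map (μ := stdNormal d) hmp.measurable.aemeasurable
      (f := fun x => Real.log (gaussRatio ⟪b i, m⟫ (w i) x))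
      (measurable_gaussRatio _ _).log.aestronglyMeasurable
    rw [hmp.map_eq] at h
    rw [← h]
    exact integral_log_gaussRatio_le _ hc (hw i)
  refine (Finset.sum_le_sum fun i _ => hi i).trans_eq ?_
  rw [← Finset.sum_div, Finset.sum_add_distrib, b.sum_sq_inner_right]

/-- The tail of the log-likelihood ratio, by Markov's inequality for its positive part. The
negative part has expectation at most `1`, because `∫ (f / g)⁻¹ df = 1`. -/
lemma tail_diagGaussian_le {c : ℝ} (hc : 0 < c) (hw : ∀ i, c ≤ w i) {t : ℝ} (ht : 0 < t) :
    (stdNormal d).real {x | Real.exp t < likelihoodRatio (stdNormal d) (diagGaussian b m w) x}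
      ≤ ((∑ i, ((w i : ℝ) - 1) ^ 2 + ‖m‖ ^ 2) / (2 * c) + 1) / t := by
  have hw0 : ∀ i, w i ≠ 0 := fun i h => by
    have := hc.trans_le (hw i); simp [h] at this
  set r := diagRatio b m w with hr
  have hrm : Measurable r := measurable_diagRatio b m w
  have hrpos : ∀ x, 0 < r x := diagRatio_pos b m hw0
  have hlogI : Integrable (fun x => Real.log (r x)) (stdNormal d) :=
    integrable_log_diagRatio b m hw0
  have hinv : ∫⁻ x, ENNReal.ofReal (r x)⁻¹ ∂(stdNormal d) = 1 := by
    rw [stdNormal_eq_withDensity b m hw0, lintegral_withDensity_eq_lintegral_mul _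
      hrm.ennreal_ofReal (by fun_prop)]
    have : ∀ x, ((fun x => ENNReal.ofReal (r x)) * fun x => ENNReal.ofReal (r x)⁻¹) x = 1 := by
      intro x
      rw [Pi.mul_apply, ← ENNReal.ofReal_mul (hrpos x).le, mul_inv_cancel₀ (hrpos x).ne',
        ENNReal.ofReal_one]
    simp only [this]
    simp
  have hinvI : Integrable (fun x => (r x)⁻¹) (stdNormal d) := by
    refine ⟨by fun_prop, ?_⟩
    rw [hasFiniteIntegral_iff_ofReal (ae_of_all _ fun x => (inv_pos.2 (hrpos x)).le), hinv]
    exact ENNReal.one_lt_top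
  have hinv1 : ∫ x, (r x)⁻¹ ∂(stdNormal d) = 1 := by
    rw [integral_eq_lintegral_of_nonneg_ae (ae_of_all _ fun x => (inv_pos.2 (hrpos x)).le)
      (by fun_prop), hinv]
    simp
  have hae : likelihoodRatio (stdNormal d) (diagGaussian b m w) =ᵐ[stdNormal d] r :=
    (absolutelyContinuous_diagGaussian b m hw0).ae_eq (likelihoodRatio_diagGaussian b m)
  have hposI : Integrable (fun x => max (Real.log (r x)) 0) (stdNormal d) := hlogI.pos_part
  have hle : ∫ x, max (Real.log (r x)) 0 ∂(stdNormal d)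
      ≤ ∫ x, Real.log (r x) ∂(stdNormal d) + 1 := by
    rw [← hinv1, ← integral_add hlogI hinvI]
    refine integral_mono hposI (hlogI.add hinvI) fun x => ?_
    have h1 := Real.log_le_sub_one_of_pos (inv_pos.2 (hrpos x))
    rw [Real.log_inv] at h1
    have h2 := inv_pos.2 (hrpos x)
    exact max_le (by linarith) (by linarith)
  have hmark := mul_meas_ge_le_integral_of_nonneg (μ := stdNormal d)
    (ae_of_all _ fun x => le_max_right (Real.log (r x)) 0) hposI t
  rw [le_div_iff₀ ht, mul_comm]
  refine le_trans ?_ (hmark.trans (hle.trans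
    (by gcongr; exact integral_log_diagRatio_le b m hc hw)))
  refine mul_le_mul_of_nonneg_left ?_ ht.le
  refine ENNReal.toReal_mono (measure_ne_top (stdNormal d) _) (measure_mono_ae ?_)
  filter_upwards [hae] with x hx hxt
  change Real.exp t < _ at hxt
  rw [hx, ← Real.lt_log_iff_exp_lt (hrpos x)] at hxt
  exact hxt.le.trans (le_max_left _ _)

end Diagonal

/-! ### Gaussian distributions whose covariance is corrected along an orthonormal family -/

section Projected

variable {d r : ℕ}

lemma exists_orthonormalBasis_extending (hr : r ≤ d) {dir : Fin r → E d}
    (hdir : Orthonormal ℝ dir) :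
    ∃ (b : OrthonormalBasis (Fin d) ℝ (E d)) (e : Fin r → Fin d),
      Function.Injective e ∧ ∀ k, b (e k) = dir k := by
  set e : Fin r → Fin d := Fin.castLE hr with he
  have hinj : Function.Injective e := Fin.castLE_injective hr
  have hon : Orthonormal ℝ ((Set.range e).domRestrict (Function.extend e dir 0)) := by
    have hcomp := hdir.comp (Equiv.ofInjective e hinj).symm (Equiv.injective _)
    convert hcomp using 1
    ext1 ⟨i, k, hk⟩
    subst hk
    simp [Set.domRestrict, hinj.extend_apply, Equiv.ofInjective_symm_apply]
  obtain ⟨b, hb⟩ := hon.exists_orthonormalBasis_extension_of_card_eq (by simp)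
  exact ⟨b, e, hinj, fun k => by rw [hb _ ⟨k, rfl⟩, hinj.extend_apply]⟩

lemma dotProduct_eq_inner (x y : E d) : x.ofLp ⬝ᵥ y.ofLp = ⟪x, y⟫ := by
  rw [EuclideanSpace.inner_eq_star_dotProduct, dotProduct_comm]
  simp

lemma dotProduct_projCov_mulVec (S : Matrix (Fin d) (Fin d) ℝ) (dir : Fin r → E d) (t : E d) :
    t.ofLp ⬝ᵥ (projCov S dir *ᵥ t.ofLp)
      = ∑ k, ((dir k).ofLp ⬝ᵥ (S *ᵥ (dir k).ofLp) - 1) * ⟪dir k, t⟫ ^ 2 + ‖t‖ ^ 2 := by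
  rw [projCov, Matrix.add_mulVec, Matrix.one_mulVec, dotProduct_add, dotProduct_eq_inner t t,
    real_inner_self_eq_norm_sq, Matrix.sum_mulVec, dotProduct_sum]
  congr 1
  refine Finset.sum_congr rfl fun k _ => ?_
  rw [Matrix.smul_mulVec, Matrix.vecMulVec_mulVec, dotProduct_smul, dotProduct_eq_inner]
  simp only [dotProduct_smul, dotProduct_eq_inner, smul_eq_mul, MulOpposite.smul_eq_mul_unop,
    MulOpposite.unop_op]
  rw [real_inner_comm t (dir k)]
  ring

/-- The variances, in an orthonormal basis that extends `dir` along `e`, of a distribution with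
variances `v` along `dir` and `1` orthogonally to it. -/
noncomputable def extendVar (e : Fin r → Fin d) (v : Fin r → ℝ) : Fin d → ℝ≥0 :=
  Function.extend e (fun k => (v k).toNNReal) 1

lemma extendVar_apply {e : Fin r → Fin d} (he : Function.Injective e) {v : Fin r → ℝ}
    (hv : ∀ k, 0 ≤ v k) (k : Fin r) : (extendVar e v (e k) : ℝ) = v k := by
  rw [extendVar, he.extend_apply, Real.coe_toNNReal _ (hv k)]

lemma extendVar_of_notMem {e : Fin r → Fin d} {v : Fin r → ℝ} {i : Fin d}
    (hi : i ∉ Set.range e) : extendVar e v i = 1 := by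
  rw [extendVar, Function.extend_apply' _ _ _ (by simpa using hi), Pi.one_apply]

/-- Sums over the whole basis reduce to sums over the family when the summand vanishes for unit
variance. -/
lemma sum_extendVar {M : Type*} [AddCommMonoid M] {e : Fin r → Fin d}
    (he : Function.Injective e) {v : Fin r → ℝ} (hv : ∀ k, 0 ≤ v k) (F : ℝ → Fin d → M)
    (hF : ∀ i, F 1 i = 0) :
    ∑ i, F (extendVar e v i) i = ∑ k, F (v k) (e k) := by
  symm
  refine Fintype.sum_of_injective e he _ _ (fun i hi => ?_) fun k => ?_
  · rw [extendVar_of_notMem hi, NNReal.coe_one, hF]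
  · rw [extendVar_apply he hv]

lemma le_extendVar {e : Fin r → Fin d} (he : Function.Injective e) {v : Fin r → ℝ}
    {c : ℝ} (hc0 : 0 ≤ c) (hc1 : c ≤ 1) (hv : ∀ k, c ≤ v k) (i : Fin d) :
    c ≤ extendVar e v i := by
  by_cases hi : i ∈ Set.range e
  · obtain ⟨k, rfl⟩ := hi
    rw [extendVar_apply he fun k => hc0.trans (hv k)]
    exact hv k
  · rw [extendVar_of_notMem hi]
    simpa using hc1

lemma charFun_diagGaussian (b : OrthonormalBasis (Fin d) ℝ (E d)) (m : E d) (w : Fin d → ℝ≥0)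
    (t : E d) :
    charFun (diagGaussian b m w) t
      = Complex.exp (⟪t, m⟫ * Complex.I - ((∑ i, w i * ⟪b i, t⟫ ^ 2 : ℝ) : ℂ) / 2) := by
  rw [charFun_apply, diagGaussian,
    integral_map (measurable_sum_smul_basis b).aemeasurable
    (Measurable.aestronglyMeasurable (by fun_prop))]
  simp_rw [sum_inner, Complex.ofReal_sum, Finset.sum_mul, Complex.exp_sum,
    integral_fintype_prod_eq_prod
      (f := fun i (x : ℝ) ↦ Complex.exp ((⟪x • b i, t⟫ : ℝ) * Complex.I)),
    real_inner_smul_left, mul_comm _ (⟪_, _⟫), Complex.ofReal_mul, ← charFun_apply_real,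
    charFun_gaussianReal]
  rw [← Complex.exp_sum, Finset.sum_sub_distrib, Finset.sum_div]
  congr 2
  · rw [← Finset.sum_mul, ← b.sum_inner_mul_inner t m]
    push_cast
    congr 1
    exact Finset.sum_congr rfl fun i _ => by rw [real_inner_comm t]
  · push_cast
    rfl

/-- `N(m, Σ_proj)` is diagonal in any orthonormal basis that extends the family. -/
lemma multivariateGaussian_projCov {b : OrthonormalBasis (Fin d) ℝ (E d)} {e : Fin r → Fin d}
    (he : Function.Injective e) {dir : Fin r → E d} (hb : ∀ k, b (e k) = dir k)
    {S : Matrix (Fin d) (Fin d) ℝ} {v : Fin r → ℝ}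
    (hv : ∀ k, v k = (dir k).ofLp ⬝ᵥ (S *ᵥ (dir k).ofLp)) (hv0 : ∀ k, 0 ≤ v k) (m : E d) :
    multivariateGaussian m (projCov S dir) = diagGaussian b m (extendVar e v) := by
  have hquad : ∀ t : E d, t.ofLp ⬝ᵥ (projCov S dir *ᵥ t.ofLp)
      = ∑ i, extendVar e v i * ⟪b i, t⟫ ^ 2 := by
    intro t
    rw [dotProduct_projCov_mulVec, ← b.sum_sq_inner_right t]
    simp only [← hv]
    simp only [← hb]
    rw [← sum_extendVar he hv0 (fun x i => (x - 1) * ⟪b i, t⟫ ^ 2) (by simp),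
      ← Finset.sum_add_distrib]
    exact Finset.sum_congr rfl fun i _ => by ring
  have hpos : (projCov S dir).PosSemidef := by
    refine Matrix.PosSemidef.of_dotProduct_mulVec_nonneg ?_ fun x => ?_
    · rw [Matrix.IsHermitian, projCov]
      simp [Matrix.conjTranspose_eq_transpose_of_trivial, Matrix.transpose_sum]
    · have := hquad (WithLp.toLp 2 x)
      simp only [star_trivial] at this ⊢
      rw [this]
      positivity
  refine Measure.ext_of_charFun (funext fun t => ?_)
  rw [charFun_multivariateGaussian hpos, charFun_diagGaussian, hquad]

/-- The affine map that takes the standard Gaussian distribution to `N(m, Σ_proj)`. -/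
noncomputable def projMap (dir : Fin r → E d) (v : Fin r → ℝ) (m x : E d) : E d :=
  m + x + ∑ k, ((√(v k) - 1) * ⟪dir k, x⟫) • dir k

/-- The density of the standard Gaussian distribution with respect to `N(m, Σ_proj)`; it is `0`
when one of the variances `v k` is `0`. -/
noncomputable def projRatio (dir : Fin r → E d) (v : Fin r → ℝ) (m x : E d) : ℝ :=
  (∏ k, √(v k)) * Real.exp ((‖x - m‖ ^ 2 - ‖x‖ ^ 2
    + ∑ k, ((v k)⁻¹ - 1) * ⟪dir k, x - m⟫ ^ 2) / 2)

lemma map_projMap_stdNormal {b : OrthonormalBasis (Fin d) ℝ (E d)} {e : Fin r → Fin d}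
    (he : Function.Injective e) {dir : Fin r → E d} (hb : ∀ k, b (e k) = dir k)
    {v : Fin r → ℝ} (hv0 : ∀ k, 0 ≤ v k) (m : E d) :
    (stdNormal d).map (projMap dir v m) = diagGaussian b m (extendVar e v) := by
  have hm : Measurable (projMap dir v m) := by unfold projMap; fun_prop
  have hcomp : projMap dir v m ∘ (fun z : Fin d → ℝ => ∑ i, z i • b i)
      = (fun z : Fin d → ℝ => ∑ i, z i • b i)
        ∘ fun z i => ⟪b i, m⟫ + √(extendVar e v i) * z i := by
    ext1 z
    simp only [Function.comp_apply, projMap, ← hb, inner_basis_sum_smul]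
    rw [← sum_extendVar he hv0 (fun x i => ((√x - 1) * z i) • b i) (by simp)]
    conv_lhs => rw [← b.sum_repr' m]
    rw [← Finset.sum_add_distrib, ← Finset.sum_add_distrib]
    refine Finset.sum_congr rfl fun i _ => ?_
    simp only [← add_smul]
    congr 1
    ring
  have hpi : ∀ i, (gaussianReal 0 1).map (fun z => ⟪b i, m⟫ + √(extendVar e v i) * z)
      = gaussianReal ⟪b i, m⟫ (extendVar e v i) := by
    intro i
    have : (fun z => ⟪b i, m⟫ + √(extendVar e v i) * z)
      = (⟪b i, m⟫ + ·) ∘ (√(extendVar e v i : ℝ) * ·) := rfl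
    rw [this, ← Measure.map_map (by fun_prop) (by fun_prop), gaussianReal_map_const_mul,
      gaussianReal_map_const_add]
    congr 1
    · simp
    · ext
      simp
  have : ∀ i, SigmaFinite ((gaussianReal 0 1).map
      (fun z => ⟪b i, m⟫ + √(extendVar e v i) * z)) := fun i => by
    rw [hpi]; infer_instance
  rw [stdNormal, stdGaussian_eq_map_pi_orthonormalBasis b,
    Measure.map_map hm (measurable_sum_smul_basis b), hcomp,
    ← Measure.map_map (measurable_sum_smul_basis b) (by fun_prop),
    Measure.pi_map_pi (f := fun i z => ⟪b i, m⟫ + √(extendVar e v i) * z)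
      (fun i => by fun_prop), diagGaussian]
  simp only [hpi]

lemma diagRatio_extendVar {b : OrthonormalBasis (Fin d) ℝ (E d)} {e : Fin r → Fin d}
    (he : Function.Injective e) {dir : Fin r → E d} (hb : ∀ k, b (e k) = dir k)
    {v : Fin r → ℝ} (hv0 : ∀ k, 0 ≤ v k) (m x : E d) :
    diagRatio b m (extendVar e v) x = projRatio dir v m x := by
  simp only [diagRatio, gaussRatio, projRatio, Finset.prod_mul_distrib, ← Real.exp_sum]
  congr 1
  · symm
    refine Fintype.prod_of_injective e he _ _ (fun i hi => ?_) fun k => ?_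
    · rw [extendVar_of_notMem hi]; simp
    · rw [extendVar_apply he hv0]
  · congr 1
    rw [← Finset.sum_div, ← b.sum_sq_inner_right (x - m), ← b.sum_sq_inner_right x]
    simp only [← hb]
    rw [← sum_extendVar he hv0 (fun y i => (y⁻¹ - 1) * ⟪b i, x - m⟫ ^ 2) (by simp),
      ← Finset.sum_sub_distrib, ← Finset.sum_add_distrib]
    congr 1
    refine Finset.sum_congr rfl fun i _ => ?_
    rw [inner_sub_right]
    ring

/-- A functional of the sampled points and of their weights, as an integral with respect to a
fixed distribution. -/
lemma integral_pi_projected (hr : r ≤ d) {dir : Fin r → E d} (hdir : Orthonormal ℝ dir)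
    {S : Matrix (Fin d) (Fin d) ℝ} {v : Fin r → ℝ}
    (hv : ∀ k, v k = (dir k).ofLp ⬝ᵥ (S *ᵥ (dir k).ofLp)) (hv0 : ∀ k, 0 ≤ v k) (m : E d)
    {n : ℕ} {G : (Fin n → ℝ) × (Fin n → E d) → ℝ} (hG : Measurable G) :
    ∫ y, G (fun i => likelihoodRatio (stdNormal d) (multivariateGaussian m (projCov S dir)) (y i),
        y) ∂(Measure.pi fun _ => multivariateGaussian m (projCov S dir))
      = ∫ z : Fin n → E d, G (fun i => projRatio dir v m (projMap dir v m (z i)),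
        fun i => projMap dir v m (z i)) ∂(Measure.pi fun _ => stdNormal d) := by
  obtain ⟨b, e, he, hb⟩ := exists_orthonormalBasis_extending hr hdir
  have hT : Measurable (projMap dir v m) := by unfold projMap; fun_prop
  have hR : Measurable (projRatio dir v m) := by unfold projRatio; fun_prop
  have hmap := map_projMap_stdNormal he hb hv0 m
  rw [multivariateGaussian_projCov he hb hv hv0]
  have hae : ∀ᵐ y ∂(Measure.pi fun _ : Fin n => diagGaussian b m (extendVar e v)),
      ∀ i, likelihoodRatio (stdNormal d) (diagGaussian b m (extendVar e v)) (y i)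
        = projRatio dir v m (y i) := by
    rw [ae_all_iff]
    intro i
    have h := likelihoodRatio_diagGaussian b m (w := extendVar e v)
    have h2 := (measurePreserving_eval (fun _ : Fin n => diagGaussian b m (extendVar e v))
      i).quasiMeasurePreserving.ae h
    filter_upwards [h2] with y hy
    rw [← diagRatio_extendVar he hb hv0]
    exact hy
  calc _ = ∫ y : Fin n → E d, G (fun i => projRatio dir v m (y i), y)
        ∂(Measure.pi fun _ => diagGaussian b m (extendVar e v)) := by
        refine integral_congr_ae ?_
        filter_upwards [hae] with y hy
        simp only [hy]
    _ = _ := by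
        have hprob : IsProbabilityMeasure ((stdNormal d).map (projMap dir v m)) := by
          rw [hmap]; infer_instance
        have hpi : (Measure.pi fun _ : Fin n => stdNormal d).map
            (fun z i => projMap dir v m (z i))
            = Measure.pi fun _ => diagGaussian b m (extendVar e v) := by
          rw [Measure.pi_map_pi (f := fun _ => projMap dir v m) (fun _ => hT.aemeasurable)]
          simp only [hmap]
        have hTn : Measurable fun (z : Fin n → E d) i => projMap dir v m (z i) :=
          measurable_pi_lambda _ fun i => hT.comp (measurable_pi_apply i)
        have hRn : Measurable fun (y : Fin n → E d) i => projRatio dir v m (y i) :=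
          measurable_pi_lambda _ fun i => hR.comp (measurable_pi_apply i)
        rw [← hpi, integral_map hTn.aemeasurable]
        exact (hG.comp (hRn.prodMk measurable_id)).aestronglyMeasurable

lemma measurable_projMap {X : Type*} [MeasurableSpace X] {dir : X → Fin r → E d}
    (hdir : ∀ k, Measurable fun a => dir a k) {v : X → Fin r → ℝ}
    (hv : ∀ k, Measurable fun a => v a k) {m x : X → E d} (hm : Measurable m)
    (hx : Measurable x) : Measurable fun a => projMap (dir a) (v a) (m a) (x a) := by
  unfold projMap
  refine (hm.add hx).add (Finset.measurable_sum _ fun k _ => ?_)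
  exact ((((hv k).sqrt).sub_const 1).mul ((hdir k).inner hx)).smul (hdir k)

lemma measurable_projRatio {X : Type*} [MeasurableSpace X] {dir : X → Fin r → E d}
    (hdir : ∀ k, Measurable fun a => dir a k) {v : X → Fin r → ℝ}
    (hv : ∀ k, Measurable fun a => v a k) {m x : X → E d} (hm : Measurable m)
    (hx : Measurable x) : Measurable fun a => projRatio (dir a) (v a) (m a) (x a) := by
  unfold projRatio
  refine (Finset.measurable_prod _ fun k _ => (hv k).sqrt).mul (Measurable.exp ?_)
  refine Measurable.div_const ?_ 2
  refine (((hx.sub hm).norm.pow_const 2).sub (hx.norm.pow_const 2)).add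
    (Finset.measurable_sum _ fun k _ => ?_)
  exact ((hv k).inv.sub_const 1).mul (((hdir k).inner (hx.sub hm)).pow_const 2)

lemma measurable_quadForm {X : Type*} [MeasurableSpace X] {S : X → Matrix (Fin d) (Fin d) ℝ}
    (hS : ∀ i j, Measurable fun a => S a i j) {u : X → E d} (hu : Measurable u) :
    Measurable fun a => (u a).ofLp ⬝ᵥ (S a *ᵥ (u a).ofLp) := by
  have hui : ∀ i, Measurable fun a => (u a).ofLp i := fun i => by fun_prop
  simp only [dotProduct, Matrix.mulVec]
  exact Finset.measurable_sum _ fun i _ => (hui i).mul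
    (Finset.measurable_sum _ fun j _ => (hS i j).mul (hui j))

lemma aemeasurable_integral_pi_projected {Ω : Type*} [MeasurableSpace Ω] {P : Measure Ω}
    (hr : r ≤ d) {dir : Ω → Fin r → E d} (hdir_meas : Measurable dir)
    (hdir : ∀ᵐ ω ∂P, Orthonormal ℝ (dir ω)) {S : Ω → Matrix (Fin d) (Fin d) ℝ}
    (hS : ∀ i j, Measurable fun ω => S ω i j)
    (hS0 : ∀ ω (u : E d), 0 ≤ u.ofLp ⬝ᵥ (S ω *ᵥ u.ofLp)) {m : Ω → E d} (hm : Measurable m)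
    {n : ℕ} {G : (Fin n → ℝ) × (Fin n → E d) → ℝ} (hG : Measurable G) :
    AEMeasurable (fun ω => ∫ y, G (fun i => likelihoodRatio (stdNormal d)
        (multivariateGaussian (m ω) (projCov (S ω) (dir ω))) (y i), y)
        ∂(Measure.pi fun _ => multivariateGaussian (m ω) (projCov (S ω) (dir ω)))) P := by
  let v : Ω → Fin r → ℝ := fun ω k => (dir ω k).ofLp ⬝ᵥ (S ω *ᵥ (dir ω k).ofLp)
  have hdk : ∀ k, Measurable fun ω => dir ω k := fun k => (measurable_pi_apply k).comp hdir_meas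
  have hvm : ∀ k, Measurable fun ω => v ω k := fun k => measurable_quadForm hS (hdk k)
  have h1 : ∀ k, Measurable fun p : Ω × (Fin n → E d) => dir p.1 k :=
    fun k => (hdk k).comp measurable_fst
  have h2 : ∀ k, Measurable fun p : Ω × (Fin n → E d) => v p.1 k :=
    fun k => (hvm k).comp measurable_fst
  have h3 : Measurable fun p : Ω × (Fin n → E d) => m p.1 := hm.comp measurable_fst
  have hpt : ∀ i : Fin n, Measurable fun p : Ω × (Fin n → E d) =>
      projMap (dir p.1) (v p.1) (m p.1) (p.2 i) := fun i =>
    measurable_projMap h1 h2 h3 ((measurable_pi_apply i).comp measurable_snd)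
  have hrat : ∀ i : Fin n, Measurable fun p : Ω × (Fin n → E d) =>
      projRatio (dir p.1) (v p.1) (m p.1) (projMap (dir p.1) (v p.1) (m p.1) (p.2 i)) := fun i =>
    measurable_projRatio h1 h2 h3 (hpt i)
  have hjoint : Measurable fun p : Ω × (Fin n → E d) =>
      G (fun i => projRatio (dir p.1) (v p.1) (m p.1) (projMap (dir p.1) (v p.1) (m p.1) (p.2 i)),
        fun i => projMap (dir p.1) (v p.1) (m p.1) (p.2 i)) :=
    hG.comp ((measurable_pi_lambda _ hrat).prodMk (measurable_pi_lambda _ hpt))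
  refine ⟨fun ω => ∫ z : Fin n → E d, G (fun i => projRatio (dir ω) (v ω) (m ω)
    (projMap (dir ω) (v ω) (m ω) (z i)), fun i => projMap (dir ω) (v ω) (m ω) (z i))
    ∂(Measure.pi fun _ => stdNormal d), ?_, ?_⟩
  · exact hjoint.stronglyMeasurable.integral_prod_right.measurable
  · filter_upwards [hdir] with ω hω
    exact integral_pi_projected hr hω (fun _ => rfl) (fun _ => hS0 _ _) _ hG

lemma aemeasurable_weightDegeneracy {Ω : Type*} [MeasurableSpace Ω] {P : Measure Ω}
    (hr : r ≤ d) {dir : Ω → Fin r → E d} (hdir_meas : Measurable dir)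
    (hdir : ∀ᵐ ω ∂P, Orthonormal ℝ (dir ω)) {S : Ω → Matrix (Fin d) (Fin d) ℝ}
    (hS : ∀ i j, Measurable fun ω => S ω i j)
    (hS0 : ∀ ω (u : E d), 0 ≤ u.ofLp ⬝ᵥ (S ω *ᵥ u.ofLp)) {m : Ω → E d} (hm : Measurable m)
    (n : ℕ) :
    AEMeasurable (fun ω => weightDegeneracy (stdNormal d)
      (multivariateGaussian (m ω) (projCov (S ω) (dir ω))) n) P := by
  refine aemeasurable_integral_pi_projected hr hdir_meas hdir hS hS0 hm
    (G := fun p => (⨆ i, p.1 i) / ∑ i, p.1 i) ?_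
  refine Measurable.div (Measurable.iSup fun i => ?_) ?_ <;> fun_prop

lemma aemeasurable_relativeL1Error {Ω : Type*} [MeasurableSpace Ω] {P : Measure Ω}
    (hr : r ≤ d) {dir : Ω → Fin r → E d} (hdir_meas : Measurable dir)
    (hdir : ∀ᵐ ω ∂P, Orthonormal ℝ (dir ω)) {S : Ω → Matrix (Fin d) (Fin d) ℝ}
    (hS : ∀ i j, Measurable fun ω => S ω i j)
    (hS0 : ∀ ω (u : E d), 0 ≤ u.ofLp ⬝ᵥ (S ω *ᵥ u.ofLp)) {m : Ω → E d} (hm : Measurable m)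
    {A : Set (E d)} (hA : MeasurableSet A) (n : ℕ) :
    AEMeasurable (fun ω => relativeL1Error (stdNormal d) A
      (multivariateGaussian (m ω) (projCov (S ω) (dir ω))) n) P := by
  refine aemeasurable_integral_pi_projected hr hdir_meas hdir hS hS0 hm
    (G := fun p => |1 / ((stdNormal d).real A * n) * ∑ i, p.1 i * A.indicator 1 (p.2 i) - 1|) ?_
  have : Measurable (A.indicator (1 : E d → ℝ)) := measurable_one.indicator hA
  fun_prop

/-- If the mean and the corrections of the variances are bounded and the variances are bounded
away from `0`, the log-likelihood ratio has tails bounded independently of the dimension. -/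
lemma tail_projected_le (hr : r ≤ d) {dir : Fin r → E d} (hdir : Orthonormal ℝ dir)
    {S : Matrix (Fin d) (Fin d) ℝ} {m : E d} {c K : ℝ} (hc : 0 < c) (hc1 : c ≤ 1)
    (hv : ∀ k, c ≤ (dir k).ofLp ⬝ᵥ (S *ᵥ (dir k).ofLp))
    (hK : ∑ k, ((dir k).ofLp ⬝ᵥ (S *ᵥ (dir k).ofLp) - 1) ^ 2 + ‖m‖ ^ 2 ≤ K) :
    stdNormal d ≪ multivariateGaussian m (projCov S dir) ∧ ∀ t > 0,
      (stdNormal d).real {x | Real.exp t < likelihoodRatio (stdNormal d)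
        (multivariateGaussian m (projCov S dir)) x} ≤ (K / (2 * c) + 1) / t := by
  obtain ⟨b, e, he, hb⟩ := exists_orthonormalBasis_extending hr hdir
  set v : Fin r → ℝ := fun k => (dir k).ofLp ⬝ᵥ (S *ᵥ (dir k).ofLp) with hvdef
  have hv0 : ∀ k, 0 ≤ v k := fun k => hc.le.trans (hv k)
  rw [multivariateGaussian_projCov he hb (fun _ => rfl) hv0]
  have hw : ∀ i, c ≤ extendVar e v i := le_extendVar he hc.le hc1 hv
  refine ⟨absolutelyContinuous_diagGaussian b m fun i h => ?_, fun t ht => ?_⟩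
  · exact (hc.trans_le (hw i)).ne' (by rw [h, NNReal.coe_zero])
  · refine (tail_diagGaussian_le b m hc hw ht).trans ?_
    rw [sum_extendVar he hv0 (fun x _ => (x - 1) ^ 2) (by simp)]
    gcongr

end Projected

/-! ### Moments of the conditioned Gaussian distribution -/

section Conditional

variable {d : ℕ} {A : Set (E d)}

lemma isProbabilityMeasure_condNormal (hp : 0 < (stdNormal d).real A) :
    IsProbabilityMeasure (condNormal A) :=
  cond_isProbabilityMeasure fun h => by simp [measureReal_def, h] at hp

lemma condNormal_le (A : Set (E d)) :
    condNormal A ≤ (stdNormal d A)⁻¹ • stdNormal d := by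
  rw [condNormal, ProbabilityTheory.cond]
  gcongr
  exact Measure.restrict_le_self

lemma inv_measure_ne_top (hp : 0 < (stdNormal d).real A) : (stdNormal d A)⁻¹ ≠ ∞ := by
  rw [ENNReal.inv_ne_top]
  exact fun h => by simp [measureReal_def, h] at hp

lemma memLp_condNormal (hp : 0 < (stdNormal d).real A) {h : E d → ℝ} {q : ℝ≥0∞}
    (hh : MemLp h q (stdNormal d)) : MemLp h q (condNormal A) :=
  hh.of_measure_le_smul (inv_measure_ne_top hp) (condNormal_le A)

lemma integral_condNormal_le (hp : 0 < (stdNormal d).real A) {h : E d → ℝ} (hh0 : ∀ x, 0 ≤ h x)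
    (hh : Integrable h (stdNormal d)) :
    ∫ x, h x ∂(condNormal A) ≤ ((stdNormal d).real A)⁻¹ * ∫ x, h x ∂(stdNormal d) := by
  refine (integral_mono_measure (condNormal_le A) (ae_of_all _ hh0)
    (hh.smul_measure (inv_measure_ne_top hp))).trans_eq ?_
  rw [integral_smul_measure, ENNReal.toReal_inv, smul_eq_mul, measureReal_def]

lemma measureReal_condNormal_le (A s : Set (E d)) :
    (condNormal A).real s ≤ ((stdNormal d).real A)⁻¹ * (stdNormal d).real s := by
  by_cases h0 : stdNormal d A = 0
  · have : condNormal A = 0 := cond_eq_zero_of_meas_eq_zero h0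
    simp only [this, measureReal_zero, Pi.zero_apply]
    positivity
  · have h := condNormal_le A s
    rw [Measure.smul_apply, smul_eq_mul] at h
    have h2 := ENNReal.toReal_mono
      (ENNReal.mul_ne_top (ENNReal.inv_ne_top.2 h0) (measure_ne_top (stdNormal d) s)) h
    rwa [ENNReal.toReal_mul, ENNReal.toReal_inv] at h2

lemma memLp_inner_stdNormal (u : E d) {q : ℝ≥0∞} (hq : q ≠ ∞) :
    MemLp (fun x => ⟪u, x⟫) q (stdNormal d) :=
  IsGaussian.memLp_dual (stdNormal d) (innerSL ℝ u) q hq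

lemma integral_inner_sq_stdNormal (u : E d) : ∫ x, ⟪u, x⟫ ^ 2 ∂(stdNormal d) = ‖u‖ ^ 2 := by
  have h := variance_dual_stdGaussian (innerSL ℝ u : StrongDual ℝ (E d))
  have h0 := integral_strongDual_stdGaussian (innerSL ℝ u : StrongDual ℝ (E d))
  rw [variance_of_integral_eq_zero (by fun_prop) h0] at h
  simpa using h

lemma integral_inner_condNormal (hp : 0 < (stdNormal d).real A) (u : E d) :
    ∫ x, ⟪u, x⟫ ∂(condNormal A) = ⟪u, condMean A⟫ := by
  have := isProbabilityMeasure_condNormal hp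
  have hI : Integrable (fun x : E d => x) (condNormal A) := by
    have h : MemLp id 1 (stdNormal d) := IsGaussian.memLp_id _ 1 (by simp)
    exact (h.of_measure_le_smul (inv_measure_ne_top hp) (condNormal_le A)).integrable le_rfl
  exact integral_inner hI u

lemma integral_inner_sq_condNormal_le (hp : 0 < (stdNormal d).real A) (u : E d) :
    ∫ x, ⟪u, x⟫ ^ 2 ∂(condNormal A) ≤ ((stdNormal d).real A)⁻¹ * ‖u‖ ^ 2 := by
  rw [← integral_inner_sq_stdNormal]
  exact integral_condNormal_le hp (fun _ => sq_nonneg _)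
    (memLp_inner_stdNormal u (by simp)).integrable_sq

/-- Testing the mean against itself, Cauchy-Schwarz bounds it independently of the dimension. -/
lemma norm_condMean_sq_le (hp : 0 < (stdNormal d).real A) :
    ‖condMean A‖ ^ 2 ≤ ((stdNormal d).real A)⁻¹ := by
  have := isProbabilityMeasure_condNormal hp
  have h1 := sq_integral_le (memLp_condNormal hp
    (memLp_inner_stdNormal (condMean A) (q := 2) (by simp)))
  rw [integral_inner_condNormal hp, real_inner_self_eq_norm_sq] at h1
  have h2 := integral_inner_sq_condNormal_le hp (condMean A)
  rcases (sq_nonneg ‖condMean A‖).eq_or_lt with h0 | h0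
  · rw [← h0]; positivity
  · nlinarith

/-- The fourth moment of the standard normal distribution. -/
noncomputable def fourthMoment : ℝ := ∫ x, x ^ 4 ∂(gaussianReal 0 1)

lemma fourthMoment_nonneg : 0 ≤ fourthMoment := integral_nonneg fun x => by positivity

lemma memLp_sq_gaussianReal : MemLp (fun x : ℝ => x ^ 2) 2 (gaussianReal 0 1) := by
  have h : MemLp (fun x : ℝ => x) 4 (gaussianReal 0 1) := memLp_id_gaussianReal 4
  rw [memLp_two_iff_integrable_sq (by fun_prop)]
  have h2 := h.integrable_norm_pow (p := 4) (by norm_num)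
  refine h2.congr (ae_of_all _ fun x => ?_)
  simp only [Real.norm_eq_abs]
  rw [show (4 : ℕ) = 2 * 2 from rfl, pow_mul, sq_abs, ← pow_mul]

lemma variance_sq_gaussianReal_le :
    Var[fun x : ℝ => x ^ 2 - 1; gaussianReal 0 1] ≤ fourthMoment := by
  rw [variance_sub_const memLp_sq_gaussianReal.aestronglyMeasurable]
  refine (variance_le_expectation_sq memLp_sq_gaussianReal.aestronglyMeasurable).trans_eq ?_
  simp only [Pi.pow_apply, ← pow_mul]
  rfl

lemma memLp_inner_sq_stdNormal {u : E d} (hu : ‖u‖ = 1) :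
    MemLp (fun x => ⟪u, x⟫ ^ 2) 2 (stdNormal d) :=
  memLp_sq_gaussianReal.comp_measurePreserving (measurePreserving_inner_stdNormal hu)

lemma integral_inner_pow_four_condNormal_le (hp : 0 < (stdNormal d).real A) {u : E d}
    (hu : ‖u‖ = 1) :
    ∫ x, (⟪u, x⟫ ^ 2) ^ 2 ∂(condNormal A) ≤ ((stdNormal d).real A)⁻¹ * fourthMoment := by
  refine (integral_condNormal_le hp (fun _ => sq_nonneg _)
    (memLp_inner_sq_stdNormal hu).integrable_sq).trans_eq ?_
  have hmp := measurePreserving_inner_stdNormal hu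
  have h := integral_map (μ := stdNormal d) hmp.measurable.aemeasurable
    (f := fun x : ℝ => x ^ 4) (by fun_prop)
  rw [hmp.map_eq] at h
  rw [fourthMoment, h]
  simp only [← pow_mul]

/-- In an orthonormal basis the functions `⟪b i, x⟫ ^ 2 - 1` are independent and centred. -/
lemma integral_sq_sum_le (b : OrthonormalBasis (Fin d) ℝ (E d)) (c : Fin d → ℝ) :
    ∫ x, (∑ i, c i * (⟪b i, x⟫ ^ 2 - 1)) ^ 2 ∂(stdNormal d) ≤ fourthMoment * ∑ i, c i ^ 2 := by
  have hL : ∀ i, MemLp (fun x : ℝ => c i * (x ^ 2 - 1)) 2 (gaussianReal 0 1) := fun i =>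
    (memLp_sq_gaussianReal.sub (memLp_const 1)).const_mul _
  have hvar := variance_sum_pi (μ := fun _ : Fin d => gaussianReal 0 1) hL
  have hfun : (∑ i, fun z : Fin d → ℝ => c i * (z i ^ 2 - 1))
      = fun z => ∑ i, c i * (z i ^ 2 - 1) := by ext z; simp
  have hmean : ∫ z : Fin d → ℝ, ∑ i, c i * (z i ^ 2 - 1)
      ∂(Measure.pi fun _ => gaussianReal 0 1) = 0 := by
    rw [integral_finsetSum _ fun i _ => integrable_comp_eval
      (μ := fun _ : Fin d => gaussianReal 0 1) ((hL i).integrable (by norm_num))]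
    refine Finset.sum_eq_zero fun i _ => ?_
    rw [integral_comp_eval (μ := fun _ : Fin d => gaussianReal 0 1) (hL i).aestronglyMeasurable,
      integral_const_mul, integral_sub integrable_sq_gaussianReal (integrable_const _),
      integral_sq_gaussianReal]
    simp
  rw [hfun, variance_of_integral_eq_zero (Measurable.aemeasurable (by fun_prop)) hmean] at hvar
  rw [stdNormal, stdGaussian_eq_map_pi_orthonormalBasis b,
    integral_map (measurable_sum_smul_basis b).aemeasurable
      (Measurable.aestronglyMeasurable (by fun_prop))]
  simp only [inner_basis_sum_smul]
  rw [hvar, Finset.mul_sum]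
  refine Finset.sum_le_sum fun i _ => ?_
  rw [variance_const_mul, mul_comm]
  exact mul_le_mul_of_nonneg_right variance_sq_gaussianReal_le (sq_nonneg _)

/-- Bessel's inequality for the functions `⟪b i, x⟫ ^ 2 - 1` and the density of `f|_A`. -/
lemma sum_sq_secondMoment_sub_one_le (hp : 0 < (stdNormal d).real A)
    (b : OrthonormalBasis (Fin d) ℝ (E d)) :
    ∑ i, (∫ x, ⟪b i, x⟫ ^ 2 ∂(condNormal A) - 1) ^ 2
      ≤ ((stdNormal d).real A)⁻¹ * fourthMoment := by
  have := isProbabilityMeasure_condNormal hp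
  set c : Fin d → ℝ := fun i => ∫ x, ⟪b i, x⟫ ^ 2 ∂(condNormal A) - 1 with hc
  have hLi : ∀ i, MemLp (fun x => c i * (⟪b i, x⟫ ^ 2 - 1)) 2 (stdNormal d) := fun i =>
    ((memLp_inner_sq_stdNormal (b.norm_eq_one i)).sub (memLp_const 1)).const_mul _
  have hL : MemLp (fun x => ∑ i, c i * (⟪b i, x⟫ ^ 2 - 1)) 2 (stdNormal d) :=
    memLp_finsetSum _ fun i _ => hLi i
  have hmean : ∫ x, ∑ i, c i * (⟪b i, x⟫ ^ 2 - 1) ∂(condNormal A) = ∑ i, c i ^ 2 := by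
    rw [integral_finsetSum _ fun i _ => (memLp_condNormal hp (hLi i)).integrable (by norm_num)]
    refine Finset.sum_congr rfl fun i _ => ?_
    rw [integral_const_mul, integral_sub
      ((memLp_condNormal hp (memLp_inner_sq_stdNormal (b.norm_eq_one i))).integrable (by norm_num))
      (integrable_const _), integral_const, probReal_univ, smul_eq_mul, one_mul, sq]
  have h1 := sq_integral_le (memLp_condNormal hp hL)
  rw [hmean] at h1
  have h2 := integral_condNormal_le hp (fun _ => sq_nonneg _) hL.integrable_sq
  have h3 := integral_sq_sum_le b c
  have hp' : 0 < ((stdNormal d).real A)⁻¹ := inv_pos.2 hp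
  have h4 : (∑ i, c i ^ 2) ^ 2
      ≤ ((stdNormal d).real A)⁻¹ * (fourthMoment * ∑ i, c i ^ 2) :=
    (h1.trans h2).trans (by gcongr)
  rcases (Finset.sum_nonneg fun i (_ : i ∈ Finset.univ) => sq_nonneg (c i)).eq_or_lt with h0 | h0
  · rw [← h0]
    exact mul_nonneg hp'.le fourthMoment_nonneg
  · nlinarith

lemma dotProduct_condCov_mulVec (hp : 0 < (stdNormal d).real A) (u : E d) :
    u.ofLp ⬝ᵥ (condCov A *ᵥ u.ofLp) = Var[fun x => ⟪u, x⟫; condNormal A] := by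
  have := isProbabilityMeasure_condNormal hp
  have hL : ∀ i, MemLp (fun x : E d => u i * x i) 2 (condNormal A) := fun i => by
    have h := memLp_inner_stdNormal (EuclideanSpace.single i (1 : ℝ)) (q := 2) (by simp)
    simp only [EuclideanSpace.inner_single_left, map_one, one_mul] at h
    exact (memLp_condNormal hp h).const_mul _
  have hfun : (fun x : E d => ⟪u, x⟫) = fun x => ∑ i, u i * x i := by
    ext x
    rw [← dotProduct_eq_inner]
    rfl
  rw [hfun, variance_fun_sum hL]
  simp only [dotProduct, Matrix.mulVec, condCov, Matrix.of_apply, Finset.mul_sum,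
    covariance_const_mul_left, covariance_const_mul_right]
  refine Finset.sum_congr rfl fun i _ => Finset.sum_congr rfl fun j _ => ?_
  ring

lemma dotProduct_condCov_mulVec_eq_sub (hp : 0 < (stdNormal d).real A) (u : E d) :
    u.ofLp ⬝ᵥ (condCov A *ᵥ u.ofLp)
      = ∫ x, ⟪u, x⟫ ^ 2 ∂(condNormal A) - ⟪u, condMean A⟫ ^ 2 := by
  have := isProbabilityMeasure_condNormal hp
  rw [dotProduct_condCov_mulVec hp, variance_eq_sub (memLp_condNormal hp
    (memLp_inner_stdNormal u (by simp))), integral_inner_condNormal hp]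
  rfl

lemma gaussianReal_Ioo_le (m : ℝ) {ε : ℝ} (hε : 0 ≤ ε) :
    (gaussianReal 0 1).real (Set.Ioo (m - ε) (m + ε)) ≤ ε := by
  have hpdf : ∀ x, gaussianPDF 0 1 x ≤ ENNReal.ofReal (1 / 2) := fun x => by
    refine ENNReal.ofReal_le_ofReal ?_
    rw [gaussianPDFReal]
    have h1 : Real.exp (-(x - 0) ^ 2 / (2 * (1 : ℝ≥0))) ≤ 1 := by
      rw [Real.exp_le_one_iff]
      have : 0 ≤ (x - 0) ^ 2 := sq_nonneg _
      simp only [NNReal.coe_one]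
      linarith
    have h2 : (2 : ℝ) ≤ √(2 * Real.pi * (1 : ℝ≥0)) := by
      apply Real.le_sqrt_of_sq_le
      have := Real.pi_gt_three
      simp only [NNReal.coe_one]
      linarith
    calc _ ≤ (√(2 * Real.pi * (1 : ℝ≥0)))⁻¹ * 1 := by gcongr
      _ ≤ (2 : ℝ)⁻¹ * 1 := by gcongr
      _ = 1 / 2 := by norm_num
  have h : gaussianReal 0 1 (Set.Ioo (m - ε) (m + ε)) ≤ ENNReal.ofReal ε := by
    rw [gaussianReal_apply _ one_ne_zero]
    refine (lintegral_mono hpdf).trans ?_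
    rw [setLIntegral_const, Real.volume_Ioo, ← ENNReal.ofReal_mul (by norm_num)]
    gcongr
    linarith
  exact ENNReal.toReal_le_of_le_ofReal hε h

/-- An event of probability at least `p` leaves room for a spread of order `p` in every direction,
since the standard normal distribution gives small mass to short intervals. -/
lemma le_variance_inner_condNormal (hp : 0 < (stdNormal d).real A) {u : E d} (hu : ‖u‖ = 1) :
    (stdNormal d).real A ^ 2 / 8 ≤ Var[fun x => ⟪u, x⟫; condNormal A] := by
  have := isProbabilityMeasure_condNormal hp
  set p := (stdNormal d).real A with hpdef
  set M := ∫ x, ⟪u, x⟫ ∂(condNormal A) with hM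
  have hL : MemLp (fun x => ⟪u, x⟫) 2 (condNormal A) :=
    memLp_condNormal hp (memLp_inner_stdNormal u (by simp))
  have hmark := mul_meas_ge_le_integral_of_nonneg (μ := condNormal A)
    (ae_of_all _ fun x => sq_nonneg (⟪u, x⟫ - M)) (hL.sub (memLp_const M)).integrable_sq
    ((p / 2) ^ 2)
  rw [variance_eq_integral hL.aestronglyMeasurable.aemeasurable]
  refine le_trans ?_ hmark
  set s : Set (E d) := {x | (p / 2) ^ 2 ≤ (⟪u, x⟫ - M) ^ 2} with hs
  have hsm : MeasurableSet s := measurableSet_le (by fun_prop) (by fun_prop)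
  have hmp := measurePreserving_inner_stdNormal hu
  have hcompl : (condNormal A).real sᶜ ≤ 1 / 2 := by
    refine (measureReal_condNormal_le A _).trans ?_
    have hpre : sᶜ ⊆ (fun x => ⟪u, x⟫) ⁻¹' Set.Ioo (M - p / 2) (M + p / 2) := by
      intro x hx
      simp only [hs, Set.mem_compl_iff, Set.mem_ofPred_eq, not_le] at hx
      have := abs_lt_of_sq_lt_sq hx (by positivity)
      rw [abs_lt] at this
      exact ⟨by linarith [this.1], by linarith [this.2]⟩
    have h1 : (stdNormal d).real sᶜ ≤ p / 2 := by
      refine (measureReal_mono hpre).trans ?_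
      rw [measureReal_def, hmp.measure_preimage measurableSet_Ioo.nullMeasurableSet]
      exact gaussianReal_Ioo_le M (by positivity)
    calc p⁻¹ * (stdNormal d).real sᶜ ≤ p⁻¹ * (p / 2) := by gcongr
      _ = 1 / 2 := by field_simp
  have hs1 : 1 / 2 ≤ (condNormal A).real s := by
    have := probReal_add_probReal_compl (μ := condNormal A) hsm
    linarith
  calc p ^ 2 / 8 = (p / 2) ^ 2 * (1 / 2) := by ring
    _ ≤ _ := by gcongr

end Conditional

section Family

variable {d r : ℕ} {A : Set (E d)}

lemma sum_le_sum_of_extending {b : OrthonormalBasis (Fin d) ℝ (E d)} {e : Fin r → Fin d}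
    (he : Function.Injective e) {dir : Fin r → E d} (hb : ∀ k, b (e k) = dir k) {F : E d → ℝ}
    (hF : ∀ x, 0 ≤ F x) : ∑ k, F (dir k) ≤ ∑ i, F (b i) := by
  simp only [← hb]
  rw [← Finset.sum_image (f := fun i => F (b i)) (s := Finset.univ) (g := e) he.injOn]
  exact Finset.sum_le_sum_of_subset_of_nonneg (Finset.subset_univ _) fun i _ _ => hF _

lemma sum_inner_sq_le {dir : Fin r → E d} (hdir : Orthonormal ℝ dir) (x : E d) :
    ∑ k, ⟪dir k, x⟫ ^ 2 ≤ ‖x‖ ^ 2 := by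
  have := hdir.sum_inner_products_le x (s := Finset.univ)
  simpa using this

lemma sum_sq_secondMoment_sub_one_le_of_orthonormal (hr : r ≤ d)
    (hp : 0 < (stdNormal d).real A) {dir : Fin r → E d} (hdir : Orthonormal ℝ dir) :
    ∑ k, (∫ x, ⟪dir k, x⟫ ^ 2 ∂(condNormal A) - 1) ^ 2
      ≤ ((stdNormal d).real A)⁻¹ * fourthMoment := by
  obtain ⟨b, e, he, hb⟩ := exists_orthonormalBasis_extending hr hdir
  exact (sum_le_sum_of_extending he hb
    (F := fun u => (∫ x, ⟪u, x⟫ ^ 2 ∂(condNormal A) - 1) ^ 2) fun _ => sq_nonneg _).trans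
    (sum_sq_secondMoment_sub_one_le hp b)

lemma sum_sq_condCov_sub_one_le (hr : r ≤ d) (hp : 0 < (stdNormal d).real A)
    {dir : Fin r → E d} (hdir : Orthonormal ℝ dir) :
    ∑ k, ((dir k).ofLp ⬝ᵥ (condCov A *ᵥ (dir k).ofLp) - 1) ^ 2
      ≤ 2 * (((stdNormal d).real A)⁻¹ * fourthMoment) + 2 * ((stdNormal d).real A)⁻¹ ^ 2 := by
  have h1 := sum_sq_secondMoment_sub_one_le_of_orthonormal hr hp hdir
  have h2 : ∑ k, (⟪dir k, condMean A⟫ ^ 2) ^ 2 ≤ ((stdNormal d).real A)⁻¹ ^ 2 := by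
    calc ∑ k, (⟪dir k, condMean A⟫ ^ 2) ^ 2 ≤ (∑ k, ⟪dir k, condMean A⟫ ^ 2) ^ 2 :=
          Finset.sum_sq_le_sq_sum_of_nonneg fun k _ => sq_nonneg _
      _ ≤ (‖condMean A‖ ^ 2) ^ 2 := by
          gcongr
          exact sum_inner_sq_le hdir _
      _ ≤ _ := by
          gcongr
          exact norm_condMean_sq_le hp
  calc _ ≤ ∑ k, (2 * (∫ x, ⟪dir k, x⟫ ^ 2 ∂(condNormal A) - 1) ^ 2
          + 2 * (⟪dir k, condMean A⟫ ^ 2) ^ 2) := by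
        refine Finset.sum_le_sum fun k _ => ?_
        rw [dotProduct_condCov_mulVec_eq_sub hp]
        nlinarith [sq_nonneg ((∫ x, ⟪dir k, x⟫ ^ 2 ∂(condNormal A) - 1)
          + ⟪dir k, condMean A⟫ ^ 2)]
    _ ≤ _ := by
        rw [Finset.sum_add_distrib, ← Finset.mul_sum, ← Finset.mul_sum]
        gcongr

end Family

/-! ### Empirical moments -/

section Algebra

variable {d r n : ℕ}

lemma inner_empMean (u : E d) (y : Fin n → E d) :
    ⟪u, empMean y⟫ = (n : ℝ)⁻¹ * ∑ j, ⟪u, y j⟫ := by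
  rw [empMean, real_inner_smul_right, inner_sum]

lemma dotProduct_empCov_mulVec (u : E d) (y : Fin n → E d) :
    u.ofLp ⬝ᵥ (empCov y *ᵥ u.ofLp)
      = (n : ℝ)⁻¹ * ∑ j, ⟪u, y j⟫ ^ 2 - ⟪u, empMean y⟫ ^ 2 := by
  have hone : ∀ x : E d, u.ofLp ⬝ᵥ (Matrix.vecMulVec x.ofLp x.ofLp *ᵥ u.ofLp) = ⟪u, x⟫ ^ 2 := by
    intro x
    rw [Matrix.vecMulVec_mulVec, dotProduct_eq_inner x u, dotProduct_smul, dotProduct_eq_inner,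
      MulOpposite.smul_eq_mul_unop, MulOpposite.unop_op, real_inner_comm u x, sq]
  rw [empCov, Matrix.sub_mulVec, dotProduct_sub, Matrix.smul_mulVec, dotProduct_smul,
    Matrix.sum_mulVec, dotProduct_sum, hone, smul_eq_mul]
  simp only [hone]

lemma dotProduct_empCov_mulVec_nonneg (u : E d) (y : Fin n → E d) :
    0 ≤ u.ofLp ⬝ᵥ (empCov y *ᵥ u.ofLp) := by
  rw [dotProduct_empCov_mulVec, inner_empMean, sub_nonneg]
  rcases Nat.eq_zero_or_pos n with rfl | hn
  · simp
  · have h := sq_sum_le_card_mul_sum_sq (s := Finset.univ) (f := fun j => ⟪u, y j⟫)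
    rw [Finset.card_univ, Fintype.card_fin] at h
    have hn' : (0 : ℝ) < n := by positivity
    calc ((n : ℝ)⁻¹ * ∑ j, ⟪u, y j⟫) ^ 2 = (n : ℝ)⁻¹ ^ 2 * (∑ j, ⟪u, y j⟫) ^ 2 := by ring
      _ ≤ (n : ℝ)⁻¹ ^ 2 * (n * ∑ j, ⟪u, y j⟫ ^ 2) := by gcongr
      _ = _ := by field_simp

@[fun_prop]
lemma measurable_empMean : Measurable (empMean : (Fin n → E d) → E d) := by
  unfold empMean; fun_prop

lemma measurable_empCov_apply (i j : Fin d) :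
    Measurable fun y : Fin n → E d => empCov y i j := by
  have h : ∀ y : Fin n → E d, empCov y i j
      = (n : ℝ)⁻¹ * ∑ k, y k i * y k j - empMean y i * empMean y j := by
    intro y
    simp [empCov, Matrix.sub_apply, Matrix.smul_apply, Matrix.sum_apply, Matrix.vecMulVec_apply]
  simp only [h]
  have hc : ∀ (k : Fin n) (i : Fin d), Measurable fun y : Fin n → E d => y k i :=
    fun k i => by fun_prop
  have hm : ∀ i : Fin d, Measurable fun y : Fin n → E d => empMean y i :=
    fun i => by fun_prop
  exact ((Finset.measurable_sum _ fun k _ => (hc k i).mul (hc k j)).const_mul _).sub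
    ((hm i).mul (hm j))

variable {A : Set (E d)}

/-- The empirical second moment along `u` minus its expectation under `f|_A`. -/
noncomputable def secondMomentError (A : Set (E d)) (u : E d) (y : Fin n → E d) : ℝ :=
  (n : ℝ)⁻¹ * ∑ j, ⟪u, y j⟫ ^ 2 - ∫ x, ⟪u, x⟫ ^ 2 ∂(condNormal A)

lemma empCov_sub_condCov (hp : 0 < (stdNormal d).real A) (u : E d) (y : Fin n → E d) :
    u.ofLp ⬝ᵥ (empCov y *ᵥ u.ofLp) - u.ofLp ⬝ᵥ (condCov A *ᵥ u.ofLp)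
      = secondMomentError A u y
        - ⟪u, empMean y - condMean A⟫ * ⟪u, empMean y + condMean A⟫ := by
  rw [dotProduct_empCov_mulVec, dotProduct_condCov_mulVec_eq_sub hp, secondMomentError,
    inner_sub_right, inner_add_right]
  ring

/-- Small errors of the empirical mean and of the empirical second moments along the family keep
the estimated parameters in the range where `tail_projected_le` applies. -/
lemma empirical_parameters_bound (hr : r ≤ d) (hp : 0 < (stdNormal d).real A)
    {dir : Fin r → E d} (hdir : Orthonormal ℝ dir) {y : Fin n → E d} {N c η : ℝ} (hN : 1 ≤ N)
    (hpN : ((stdNormal d).real A)⁻¹ ≤ N) (hη0 : 0 ≤ η) (hη1 : η ≤ 1) (hηc : η * (2 * N + 2) ≤ c)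
    (hc : 2 * c ≤ (stdNormal d).real A ^ 2 / 8)
    (hmean : ‖empMean y - condMean A‖ ^ 2 ≤ η ^ 2)
    (hsec : ∑ k, secondMomentError A (dir k) y ^ 2 ≤ η ^ 2) :
    (∀ k, c ≤ (dir k).ofLp ⬝ᵥ (empCov y *ᵥ (dir k).ofLp)) ∧
    ∑ k, ((dir k).ofLp ⬝ᵥ (empCov y *ᵥ (dir k).ofLp) - 1) ^ 2 + ‖empMean y‖ ^ 2
      ≤ 4 + 4 * (2 * N + 1) ^ 2 + 2 * (2 * (N * fourthMoment) + 2 * N ^ 2) + (N + 1) ^ 2 := by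
  have hδ : ‖empMean y - condMean A‖ ≤ η := abs_le_of_sq_le_sq' hmean hη0 |>.2
  have hμ : ‖condMean A‖ ≤ N := by
    have h1 := (norm_condMean_sq_le hp).trans hpN
    nlinarith [norm_nonneg (condMean A)]
  have hm : ‖empMean y‖ ≤ N + 1 := by
    calc ‖empMean y‖ = ‖(empMean y - condMean A) + condMean A‖ := by rw [sub_add_cancel]
      _ ≤ _ := (norm_add_le _ _).trans (by linarith)
  have hsum : ‖empMean y + condMean A‖ ≤ 2 * N + 1 := (norm_add_le _ _).trans (by linarith)
  have hN1 : 0 ≤ 2 * N + 1 := by linarith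
  have habs : ∀ (k : Fin r) (x : E d), |⟪dir k, x⟫| ≤ ‖x‖ := fun k x => by
    simpa [hdir.1 k] using abs_real_inner_le_norm (dir k) x
  constructor
  · intro k
    have h1 := empCov_sub_condCov hp (dir k) y
    have h2 : |secondMomentError A (dir k) y| ≤ η := by
      refine abs_le_of_sq_le_sq ((Finset.single_le_sum (f := fun k =>
        secondMomentError A (dir k) y ^ 2) (fun _ _ => sq_nonneg _) (Finset.mem_univ k)).trans
        hsec) hη0
    have h3 : |⟪dir k, empMean y - condMean A⟫ * ⟪dir k, empMean y + condMean A⟫|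
        ≤ η * (2 * N + 1) := by
      rw [abs_mul]
      exact mul_le_mul ((habs _ _).trans hδ) ((habs _ _).trans hsum) (abs_nonneg _) hη0
    have h4 := le_variance_inner_condNormal hp (hdir.1 k)
    rw [← dotProduct_condCov_mulVec hp] at h4
    have h5 := neg_abs_le (secondMomentError A (dir k) y)
    have h6 := le_abs_self (⟪dir k, empMean y - condMean A⟫ * ⟪dir k, empMean y + condMean A⟫)
    linarith
  · have hκ := fourthMoment_nonneg
    have hcov : ∑ k, ((dir k).ofLp ⬝ᵥ (condCov A *ᵥ (dir k).ofLp) - 1) ^ 2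
        ≤ 2 * (N * fourthMoment) + 2 * N ^ 2 :=
      (sum_sq_condCov_sub_one_le hr hp hdir).trans (by gcongr)
    have hcross : ∑ k, (⟪dir k, empMean y - condMean A⟫ * ⟪dir k, empMean y + condMean A⟫) ^ 2
        ≤ (2 * N + 1) ^ 2 := by
      calc _ ≤ ∑ k, ⟪dir k, empMean y - condMean A⟫ ^ 2 * (2 * N + 1) ^ 2 := by
            refine Finset.sum_le_sum fun k _ => ?_
            rw [mul_pow]
            have : ⟪dir k, empMean y + condMean A⟫ ^ 2 ≤ (2 * N + 1) ^ 2 :=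
              sq_le_sq' (by linarith [(abs_le.1 ((habs k _).trans hsum)).1])
                (abs_le.1 ((habs k _).trans hsum)).2
            gcongr
        _ ≤ 1 * (2 * N + 1) ^ 2 := by
            rw [← Finset.sum_mul]
            gcongr
            refine (sum_inner_sq_le hdir _).trans (hmean.trans ?_)
            exact pow_le_one₀ hη0 hη1
        _ = _ := one_mul _
    have hsec1 : ∑ k, secondMomentError A (dir k) y ^ 2 ≤ 1 :=
      hsec.trans (pow_le_one₀ hη0 hη1)
    have hmain : ∑ k, ((dir k).ofLp ⬝ᵥ (empCov y *ᵥ (dir k).ofLp) - 1) ^ 2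
        ≤ 4 + 4 * (2 * N + 1) ^ 2 + 2 * (2 * (N * fourthMoment) + 2 * N ^ 2) := by
      calc _ ≤ ∑ k, (4 * secondMomentError A (dir k) y ^ 2
            + 4 * (⟪dir k, empMean y - condMean A⟫ * ⟪dir k, empMean y + condMean A⟫) ^ 2
            + 2 * ((dir k).ofLp ⬝ᵥ (condCov A *ᵥ (dir k).ofLp) - 1) ^ 2) := by
            refine Finset.sum_le_sum fun k _ => ?_
            have h1 := empCov_sub_condCov hp (dir k) y
            set v' := (dir k).ofLp ⬝ᵥ (empCov y *ᵥ (dir k).ofLp)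
            set v := (dir k).ofLp ⬝ᵥ (condCov A *ᵥ (dir k).ofLp)
            set s := secondMomentError A (dir k) y
            set q := ⟪dir k, empMean y - condMean A⟫ * ⟪dir k, empMean y + condMean A⟫
            have h2 : v' = v + (s - q) := by linarith
            rw [h2]
            nlinarith [sq_nonneg ((s - q) - (v - 1)), sq_nonneg (s + q)]
        _ ≤ 4 * 1 + 4 * (2 * N + 1) ^ 2 + 2 * (2 * (N * fourthMoment) + 2 * N ^ 2) := by
            rw [Finset.sum_add_distrib, Finset.sum_add_distrib, ← Finset.mul_sum,
              ← Finset.mul_sum, ← Finset.mul_sum]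
            gcongr
        _ = _ := by ring
    have : ‖empMean y‖ ^ 2 ≤ (N + 1) ^ 2 := by gcongr
    linarith

end Algebra

section Sampling

variable {d r n : ℕ} {A : Set (E d)}

lemma integrable_norm_sq_empMean_sub (hp : 0 < (stdNormal d).real A) :
    Integrable (fun y : Fin n → E d => ‖empMean y - condMean A‖ ^ 2)
      (Measure.pi fun _ => condNormal A) := by
  have := isProbabilityMeasure_condNormal hp
  simp only [← (EuclideanSpace.basisFun (Fin d) ℝ).sum_sq_inner_right, inner_sub_right,
    inner_empMean]
  exact integrable_finsetSum _ fun i _ => integrable_sq_empirical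
    (memLp_condNormal hp (memLp_inner_stdNormal _ (by simp))) _

lemma integral_norm_sq_empMean_sub_le (hn : 0 < n) (hp : 0 < (stdNormal d).real A) :
    ∫ y : Fin n → E d, ‖empMean y - condMean A‖ ^ 2 ∂(Measure.pi fun _ => condNormal A)
      ≤ ((stdNormal d).real A)⁻¹ * (d / n) := by
  have := isProbabilityMeasure_condNormal hp
  set b := EuclideanSpace.basisFun (Fin d) ℝ
  have hL : ∀ i, MemLp (fun x => ⟪b i, x⟫) 2 (condNormal A) := fun i =>
    memLp_condNormal hp (memLp_inner_stdNormal _ (by simp))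
  simp only [← b.sum_sq_inner_right, inner_sub_right, inner_empMean,
    ← integral_inner_condNormal hp]
  rw [integral_finsetSum _ fun i _ => integrable_sq_empirical (hL i) _]
  calc _ ≤ ∑ _i : Fin d, (n : ℝ)⁻¹ * ((stdNormal d).real A)⁻¹ := by
        refine Finset.sum_le_sum fun i _ => (integral_sq_empirical_le hn (hL i)).trans ?_
        have := integral_inner_sq_condNormal_le hp (b i)
        rw [b.norm_eq_one, one_pow, mul_one] at this
        gcongr
    _ = _ := by
        rw [Finset.sum_const, Finset.card_univ, Fintype.card_fin, nsmul_eq_mul]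
        ring

lemma integrable_sum_secondMomentError (hp : 0 < (stdNormal d).real A) {dir : Fin r → E d}
    (hdir : Orthonormal ℝ dir) :
    Integrable (fun y : Fin n → E d => ∑ k, secondMomentError A (dir k) y ^ 2)
      (Measure.pi fun _ => condNormal A) := by
  have := isProbabilityMeasure_condNormal hp
  exact integrable_finsetSum _ fun k _ => integrable_sq_empirical
    (memLp_condNormal hp (memLp_inner_sq_stdNormal (hdir.1 k))) _

lemma integral_sum_secondMomentError_le (hn : 0 < n) (hp : 0 < (stdNormal d).real A)
    {dir : Fin r → E d} (hdir : Orthonormal ℝ dir) :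
    ∫ y : Fin n → E d, ∑ k, secondMomentError A (dir k) y ^ 2
        ∂(Measure.pi fun _ => condNormal A)
      ≤ ((stdNormal d).real A)⁻¹ * fourthMoment * (r / n) := by
  have := isProbabilityMeasure_condNormal hp
  have hL : ∀ k, MemLp (fun x => ⟪dir k, x⟫ ^ 2) 2 (condNormal A) := fun k =>
    memLp_condNormal hp (memLp_inner_sq_stdNormal (hdir.1 k))
  have hI : ∀ k, Integrable (fun y : Fin n → E d => secondMomentError A (dir k) y ^ 2)
      (Measure.pi fun _ => condNormal A) := fun k => integrable_sq_empirical (hL k) _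
  rw [integral_finsetSum _ fun k _ => hI k]
  calc _ ≤ ∑ _k : Fin r, (n : ℝ)⁻¹ * (((stdNormal d).real A)⁻¹ * fourthMoment) := by
        refine Finset.sum_le_sum fun k _ => (integral_sq_empirical_le hn (hL k)).trans ?_
        have := integral_inner_pow_four_condNormal_le hp (hdir.1 k)
        gcongr
    _ = _ := by
        rw [Finset.sum_const, Finset.card_univ, Fintype.card_fin, nsmul_eq_mul]
        ring

lemma measure_lt_le_of_integral_le {X : Type*} [MeasurableSpace X] {ν : Measure X}
    [IsFiniteMeasure ν] {h : X → ℝ} (h0 : ∀ x, 0 ≤ h x) (hI : Integrable h ν) {a q : ℝ}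
    (ha : 0 < a) (hq : ∫ x, h x ∂ν ≤ q) : ν {x | a < h x} ≤ ENNReal.ofReal (q / a) := by
  have h1 := mul_meas_ge_le_integral_of_nonneg (ae_of_all ν h0) hI a
  have h2 : ν.real {x | a < h x} ≤ q / a := by
    rw [le_div_iff₀ ha, mul_comm]
    refine le_trans ?_ (h1.trans hq)
    refine mul_le_mul_of_nonneg_left (measureReal_mono fun x hx => ?_) ha.le
    exact le_of_lt (show a < h x from hx)
  exact (ENNReal.le_ofReal_iff_toReal_le (measure_ne_top _ _)
    (measureReal_nonneg.trans h2)).2 h2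

lemma measure_mem_le_of_indepFun {Ω X Y : Type*} [MeasurableSpace Ω] [MeasurableSpace X]
    [MeasurableSpace Y] {P : Measure Ω} [IsProbabilityMeasure P] {D : Ω → X} {Z : Ω → Y}
    (hD : Measurable D) (hZ : Measurable Z) (hind : IndepFun D Z P) {T : Set (X × Y)}
    (hT : MeasurableSet T) {q : ℝ≥0∞} (hq : ∀ᵐ ω ∂P, P.map Z {y | (D ω, y) ∈ T} ≤ q) :
    P {ω | (D ω, Z ω) ∈ T} ≤ q := by
  have hlaw := (indepFun_iff_map_prod_eq_prod_map_map hD.aemeasurable hZ.aemeasurable).1 hind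
  have := Measure.isProbabilityMeasure_map (μ := P) hZ.aemeasurable
  calc P {ω | (D ω, Z ω) ∈ T} = P.map (fun ω => (D ω, Z ω)) T :=
        (Measure.map_apply (hD.prodMk hZ) hT).symm
    _ = ∫⁻ x, P.map Z (Prod.mk x ⁻¹' T) ∂(P.map D) := by rw [hlaw, Measure.prod_apply hT]
    _ = ∫⁻ ω, P.map Z (Prod.mk (D ω) ⁻¹' T) ∂P :=
        lintegral_map (measurable_measure_prodMk_left hT) hD
    _ ≤ ∫⁻ _, q ∂P := lintegral_mono_ae hq
    _ = q := by simp

lemma measurable_secondMomentError (hp : 0 < (stdNormal d).real A) {X : Type*}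
    [MeasurableSpace X] {u : X → E d} (hu : Measurable u) {y : X → Fin n → E d}
    (hy : ∀ j, Measurable fun a => y a j) :
    Measurable fun a => secondMomentError A (u a) (y a) := by
  have := isProbabilityMeasure_condNormal hp
  have h : Measurable fun u : E d => ∫ x, ⟪u, x⟫ ^ 2 ∂(condNormal A) := by
    have hj : Measurable fun z : E d × E d => ⟪z.1, z.2⟫ ^ 2 := by fun_prop
    exact hj.stronglyMeasurable.integral_prod_right.measurable
  unfold secondMomentError
  exact ((Finset.measurable_sum _ fun j _ => (hu.inner (hy j)).pow_const 2).const_mul _).sub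
    (h.comp hu)

variable {Ω : Type*} [MeasurableSpace Ω] {P : Measure Ω} [IsProbabilityMeasure P]

/-- The law of large numbers for the empirical mean and for the empirical second moments along
the family. As the family is independent of the sample, it may be taken to be fixed. -/
lemma measure_empirical_bad_le (hn : 0 < n) (hp : 0 < (stdNormal d).real A)
    {dir : Ω → Fin r → E d} (hdir_meas : Measurable dir)
    (hdir : ∀ᵐ ω ∂P, Orthonormal ℝ (dir ω)) {Y : Fin n → Ω → E d} (hY : ∀ k, Measurable (Y k))
    (hlaw : ∀ k, HasLaw (Y k) (condNormal A) P) (hind : iIndepFun Y P)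
    (hindep : IndepFun dir (fun ω k => Y k ω) P) {a : ℝ} (ha : 0 < a) :
    P {ω | ¬ (Orthonormal ℝ (dir ω) ∧
        ‖empMean (fun k => Y k ω) - condMean A‖ ^ 2 ≤ a ∧
        ∑ k, secondMomentError A (dir ω k) (fun k => Y k ω) ^ 2 ≤ a)}
      ≤ ENNReal.ofReal (((stdNormal d).real A)⁻¹ * (d / n) / a)
        + ENNReal.ofReal (((stdNormal d).real A)⁻¹ * fourthMoment * (r / n) / a) := by
  have := isProbabilityMeasure_condNormal hp
  have hYm : Measurable fun ω k => Y k ω := measurable_pi_lambda _ hY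
  have hlawY : P.map (fun ω k => Y k ω) = Measure.pi fun _ => condNormal A := by
    rw [(iIndepFun_iff_map_fun_eq_pi_map fun k => (hY k).aemeasurable).1 hind]
    simp only [(hlaw _).map_eq]
  have h1 : P {ω | a < ‖empMean (fun k => Y k ω) - condMean A‖ ^ 2}
      ≤ ENNReal.ofReal (((stdNormal d).real A)⁻¹ * (d / n) / a) := by
    have hm : MeasurableSet {y : Fin n → E d | a < ‖empMean y - condMean A‖ ^ 2} :=
      measurableSet_lt measurable_const (by fun_prop)
    have h := measure_lt_le_of_integral_le (fun _ => sq_nonneg _)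
      (integrable_norm_sq_empMean_sub (n := n) hp) ha (integral_norm_sq_empMean_sub_le hn hp)
    rwa [← hlawY, Measure.map_apply hYm hm] at h
  have h2 : P {ω | a < ∑ k, secondMomentError A (dir ω k) (fun k => Y k ω) ^ 2}
      ≤ ENNReal.ofReal (((stdNormal d).real A)⁻¹ * fourthMoment * (r / n) / a) := by
    refine measure_mem_le_of_indepFun hdir_meas hYm hindep
      (T := {z | a < ∑ k, secondMomentError A (z.1 k) z.2 ^ 2}) ?_ ?_
    · have hk : ∀ k, Measurable fun z : (Fin r → E d) × (Fin n → E d) =>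
          secondMomentError A (z.1 k) z.2 := fun k =>
        measurable_secondMomentError hp ((measurable_pi_apply k).comp measurable_fst)
          fun j => (measurable_pi_apply j).comp measurable_snd
      exact measurableSet_lt measurable_const
        (Finset.measurable_sum _ fun k _ => (hk k).pow_const 2)
    · filter_upwards [hdir] with ω hω
      rw [hlawY]
      exact measure_lt_le_of_integral_le
        (h := fun y : Fin n → E d => ∑ k, secondMomentError A (dir ω k) y ^ 2)
        (fun _ => Finset.sum_nonneg fun _ _ => sq_nonneg _)
        (integrable_sum_secondMomentError hp hω) ha (integral_sum_secondMomentError_le hn hp hω)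
  have h3 : P {ω | ¬ Orthonormal ℝ (dir ω)} = 0 := hdir
  calc _ ≤ P ({ω | ¬ Orthonormal ℝ (dir ω)}
        ∪ ({ω | a < ‖empMean (fun k => Y k ω) - condMean A‖ ^ 2}
          ∪ {ω | a < ∑ k, secondMomentError A (dir ω k) (fun k => Y k ω) ^ 2})) := by
        refine measure_mono fun ω hω => ?_
        by_contra hcon
        simp only [Set.mem_union, Set.mem_ofPred_eq, not_or, not_not, not_lt] at hcon
        exact hω hcon
    _ ≤ 0 + (_ + _) := by
        refine (measure_union_le _ _).trans (add_le_add h3.le ((measure_union_le _ _).trans ?_))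
        exact add_le_add h1 h2
    _ = _ := zero_add _

end Sampling

/-! ### Efficiency of the projected distributions -/

section Efficiency

variable {Ω : ℕ → Type*} [∀ d, MeasurableSpace (Ω d)]
  {P : ∀ d, Measure (Ω d)} [∀ d, IsProbabilityMeasure (P d)]
  {A : ∀ d, Set (E d)} {r : ℕ → ℕ} {dir : ∀ d, Ω d → Fin (r d) → E d}

lemma efficient_gProj (hA : ∀ d, MeasurableSet (A d)) {p₀ : ℝ} (hp₀ : 0 < p₀)
    (hp : ∀ d, p₀ ≤ (stdNormal d).real (A d)) (hr : ∀ d, r d ≤ d)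
    (hdir_meas : ∀ d, Measurable (dir d)) (hdir : ∀ d, ∀ᵐ ω ∂(P d), Orthonormal ℝ (dir d ω)) :
    EfficientInHighDimension P stdNormal A (fun d ω => gProj (A d) (dir d ω)) := by
  have hpos : ∀ d, 0 < (stdNormal d).real (A d) := fun d => hp₀.trans_le (hp d)
  have hS0 : ∀ d (ω : Ω d) (u : E d), 0 ≤ u.ofLp ⬝ᵥ (condCov (A d)).mulVec u.ofLp :=
    fun d ω u => by
      rw [dotProduct_condCov_mulVec (hpos d)]
      exact variance_nonneg _ _
  have hprob : ∀ d (ω : Ω d), IsProbabilityMeasure (gProj (A d) (dir d ω)) := fun d ω => by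
    unfold gProj; infer_instance
  have hp₀1 : p₀ ≤ 1 := (hp 0).trans measureReal_le_one
  refine efficientInHighDimension_of_tail hA hp₀ hp
    (C := (2 * (p₀⁻¹ * fourthMoment) + 2 * p₀⁻¹ ^ 2 + p₀⁻¹) / (2 * (p₀ ^ 2 / 8)) + 1)
    (fun d n => aemeasurable_weightDegeneracy (S := fun _ => condCov (A d))
      (m := fun _ => condMean (A d)) (hr d) (hdir_meas d) (hdir d)
      (fun _ _ => measurable_const) (hS0 d) measurable_const n)
    (fun d n => aemeasurable_relativeL1Error (S := fun _ => condCov (A d))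
      (m := fun _ => condMean (A d)) (hr d) (hdir_meas d) (hdir d)
      (fun _ _ => measurable_const) (hS0 d) measurable_const (hA d) n)
    (B := fun d => {ω | ¬ Orthonormal ℝ (dir d ω)}) ?_ fun d ω hω => ?_
  · have : ∀ d, P d {ω | ¬ Orthonormal ℝ (dir d ω)} = 0 :=
      fun d => ae_iff.1 (hdir d)
    simp only [this]
    exact tendsto_const_nhds
  · have hon : Orthonormal ℝ (dir d ω) := not_not.1 hω
    have hpd := hpos d
    have hinv : ((stdNormal d).real (A d))⁻¹ ≤ p₀⁻¹ := inv_anti₀ hp₀ (hp d)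
    have hκ := fourthMoment_nonneg
    refine tail_projected_le (hr d) hon (by positivity) ?_ (fun k => ?_) ?_
    · nlinarith
    · rw [dotProduct_condCov_mulVec hpd]
      refine le_trans ?_ (le_variance_inner_condNormal hpd (hon.1 k))
      have := hp d
      gcongr
    · refine add_le_add ((sum_sq_condCov_sub_one_le (hr d) hpd hon).trans ?_)
        ((norm_condMean_sq_le hpd).trans hinv)
      gcongr

lemma efficient_gProjHat (hA : ∀ d, MeasurableSet (A d)) {p₀ : ℝ} (hp₀ : 0 < p₀)
    (hp : ∀ d, p₀ ≤ (stdNormal d).real (A d)) (hr : ∀ d, r d ≤ d)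
    (hdir_meas : ∀ d, Measurable (dir d)) (hdir : ∀ d, ∀ᵐ ω ∂(P d), Orthonormal ℝ (dir d ω))
    {ng : ℕ → ℕ} {Y : ∀ d, Fin (ng d) → Ω d → E d} (hY : ∀ d k, Measurable (Y d k))
    (hlaw : ∀ d k, HasLaw (Y d k) (condNormal (A d)) (P d))
    (hind : ∀ d, iIndepFun (Y d) (P d))
    (hindep : ∀ d, IndepFun (dir d) (fun ω k => Y d k ω) (P d))
    (hng : Tendsto (fun d => (ng d : ℝ) / ((r d : ℝ) * (d : ℝ))) atTop atTop) :
    EfficientInHighDimension P stdNormal A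
      (fun d ω => gProjHat (fun k => Y d k ω) (dir d ω)) := by
  have hpos : ∀ d, 0 < (stdNormal d).real (A d) := fun d => hp₀.trans_le (hp d)
  have hp₀1 : p₀ ≤ 1 := (hp 0).trans measureReal_le_one
  have hκ := fourthMoment_nonneg
  have hYm : ∀ d, Measurable fun (ω : Ω d) k => Y d k ω :=
    fun d => measurable_pi_lambda _ (hY d)
  have hprob : ∀ d (ω : Ω d), IsProbabilityMeasure (gProjHat (fun k => Y d k ω) (dir d ω)) :=
    fun d ω => by unfold gProjHat; infer_instance
  set N : ℝ := p₀⁻¹ with hN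
  have hN1 : 1 ≤ N := (one_le_inv₀ hp₀).2 hp₀1
  set c : ℝ := p₀ ^ 2 / 16 with hc
  have hc0 : 0 < c := by positivity
  have hc1 : c ≤ 1 := by rw [hc]; nlinarith
  -- With errors below `η` the estimated variances stay above `c`, half of the lower bound `2 c`
  -- for the exact ones.
  set η : ℝ := c / (2 * N + 2) with hη
  have hη0 : 0 < η := by positivity
  have hη1 : η ≤ 1 := by
    rw [hη, div_le_one (by positivity)]
    linarith
  have hηc : η * (2 * N + 2) ≤ c := by
    rw [hη, div_mul_cancel₀ _ (by positivity)]
  refine efficientInHighDimension_of_tail hA hp₀ hp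
    (C := (4 + 4 * (2 * N + 1) ^ 2 + 2 * (2 * (N * fourthMoment) + 2 * N ^ 2) + (N + 1) ^ 2)
      / (2 * c) + 1)
    (fun d n => aemeasurable_weightDegeneracy (hr d) (hdir_meas d) (hdir d)
      (fun i j => (measurable_empCov_apply i j).comp (hYm d))
      (fun _ _ => dotProduct_empCov_mulVec_nonneg _ _) (measurable_empMean.comp (hYm d)) n)
    (fun d n => aemeasurable_relativeL1Error (hr d) (hdir_meas d) (hdir d)
      (fun i j => (measurable_empCov_apply i j).comp (hYm d))
      (fun _ _ => dotProduct_empCov_mulVec_nonneg _ _) (measurable_empMean.comp (hYm d)) (hA d) n)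
    (B := fun d => {ω | ¬ (Orthonormal ℝ (dir d ω) ∧
        ‖empMean (fun k => Y d k ω) - condMean (A d)‖ ^ 2 ≤ η ^ 2 ∧
        ∑ k, secondMomentError (A d) (dir d ω k) (fun k => Y d k ω) ^ 2 ≤ η ^ 2)})
    ?_ fun d ω hω => ?_
  · have hlim : Tendsto (fun d : ℕ => ENNReal.ofReal (N / η ^ 2
        * ((ng d : ℝ) / ((r d : ℝ) * (d : ℝ)))⁻¹) + ENNReal.ofReal (N * fourthMoment / η ^ 2
        * ((ng d : ℝ) / ((r d : ℝ) * (d : ℝ)))⁻¹)) atTop (𝓝 0) := by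
      have h0 := tendsto_inv_atTop_zero.comp hng
      have h1 : ∀ x : ℝ, Tendsto (fun d : ℕ => ENNReal.ofReal (x
          * ((ng d : ℝ) / ((r d : ℝ) * (d : ℝ)))⁻¹)) atTop (𝓝 0) := fun x => by
        simpa using ENNReal.tendsto_ofReal (h0.const_mul x)
      simpa using (h1 (N / η ^ 2)).add (h1 (N * fourthMoment / η ^ 2))
    refine tendsto_of_tendsto_of_tendsto_of_le_of_le' tendsto_const_nhds hlim
      (Eventually.of_forall fun _ => zero_le) ?_
    filter_upwards [hng.eventually_gt_atTop 0] with d hd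
    -- A positive quotient has a nonzero numerator and a nonzero denominator.
    have hn : 0 < ng d := by
      rcases Nat.eq_zero_or_pos (ng d) with h | h
      · simp [h] at hd
      · exact h
    have hrpos : 0 < r d := by
      rcases Nat.eq_zero_or_pos (r d) with h | h
      · simp [h] at hd
      · exact h
    have hinv : ((stdNormal d).real (A d))⁻¹ ≤ N := inv_anti₀ hp₀ (hp d)
    have hr1 : (1 : ℝ) ≤ r d := by exact_mod_cast hrpos
    have hd1 : (1 : ℝ) ≤ d := by exact_mod_cast hrpos.trans_le (hr d)
    have hdn : (d : ℝ) / ng d ≤ ((ng d : ℝ) / ((r d : ℝ) * (d : ℝ)))⁻¹ := by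
      rw [inv_div]
      gcongr
      nlinarith
    have hrn : (r d : ℝ) / ng d ≤ ((ng d : ℝ) / ((r d : ℝ) * (d : ℝ)))⁻¹ := by
      rw [inv_div]
      gcongr
      nlinarith
    refine (measure_empirical_bad_le hn (hpos d) (hdir_meas d) (hdir d) (hY d) (hlaw d) (hind d)
      (hindep d) (by positivity)).trans (add_le_add ?_ ?_)
    · rw [div_mul_eq_mul_div]
      gcongr
    · rw [div_mul_eq_mul_div]
      gcongr
  · obtain ⟨hon, hmean, hsec⟩ := not_not.1 hω
    have hinv : ((stdNormal d).real (A d))⁻¹ ≤ N := inv_anti₀ hp₀ (hp d)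
    have hc2 : 2 * c ≤ (stdNormal d).real (A d) ^ 2 / 8 := by
      have := hp d
      have : p₀ ^ 2 ≤ (stdNormal d).real (A d) ^ 2 := by gcongr
      rw [hc]
      linarith
    obtain ⟨hv, hK⟩ := empirical_parameters_bound (hr d) (hpos d) hon hN1 hinv hη0.le hη1 hηc hc2
      hmean hsec
    exact tail_projected_le (hr d) hon hc0 hc1 hv hK

end Efficiency

end HighDimIS

theorem theorem2 {Ω : ℕ → Type*} [∀ d, MeasurableSpace (Ω d)]
    (P : ∀ d, Measure (Ω d)) [∀ d, IsProbabilityMeasure (P d)]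
    (A : ∀ d, Set (HighDimIS.E d)) (hA : ∀ d, MeasurableSet (A d))
    (hp : 0 < ⨅ d, (HighDimIS.stdNormal d).real (A d))
    (r : ℕ → ℕ) (hr : ∀ d, r d ≤ d)
    (dir : ∀ d, Ω d → Fin (r d) → HighDimIS.E d)
    (hdir_meas : ∀ d, Measurable (dir d))
    (hdir : ∀ d, ∀ᵐ ω ∂(P d), Orthonormal ℝ (dir d ω)) :
    HighDimIS.EfficientInHighDimension P HighDimIS.stdNormal A
      (fun d ω => HighDimIS.gProj (A d) (dir d ω)) ∧
    ∀ (ng : ℕ → ℕ) (Y : ∀ d, Fin (ng d) → Ω d → HighDimIS.E d),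
      (∀ d k, Measurable (Y d k)) →
      (∀ d k, HasLaw (Y d k) (HighDimIS.condNormal (A d)) (P d)) →
      (∀ d, iIndepFun (Y d) (P d)) →
      (∀ d, IndepFun (dir d) (fun ω k => Y d k ω) (P d)) →
      Tendsto (fun d => (ng d : ℝ) / ((r d : ℝ) * (d : ℝ))) atTop atTop →
      HighDimIS.EfficientInHighDimension P HighDimIS.stdNormal A
        (fun d ω => HighDimIS.gProjHat (fun k => Y d k ω) (dir d ω)) := by
  have hinf : ∀ d, ⨅ d, (HighDimIS.stdNormal d).real (A d) ≤ (HighDimIS.stdNormal d).real (A d) :=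
    fun d => ciInf_le ⟨0, by rintro _ ⟨d, rfl⟩; exact measureReal_nonneg⟩ d
  exact ⟨HighDimIS.efficient_gProj hA hp hinf hr hdir_meas hdir,
    fun ng Y hY hlaw hind hindep hng =>
      HighDimIS.efficient_gProjHat hA hp hinf hr hdir_meas hdir hY hlaw hind hindep hng⟩
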